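/- Let $\Bbbk$ be a field and let $\mathbf z=(z_{ij})_{1\le i,j\le n}$ be a matrix of indeterminates. For $\pi\in S_n$ put $r_{pq}(\pi)=\#\{i\le p\mid \pi(i)\le q\}$ and $D(\pi)=\{(p,q)\mid \pi(p)>q,\ \pi^{-1}(q)>p\}$, and let $\mathrm{Ess}(\pi)$ be the set of $(p,q)\in D(\pi)$ with $(p+1,q),(p,q+1)\notin D(\pi)$. Let $I_\pi\subseteq\Bbbk[\mathbf z]$ be the ideal generated by the minors of size $1+r_{pq}(\pi)$ of the northwest $p\times q$ submatrix of $\mathbf z$, for all $p,q$; those with $(p,q)\in\mathrm{Ess}(\pi)$ are the essential minors of $I_\pi$. Call $\pi$ vexillary if there are no $a<b<c<d$ with $\pi(b)<\pi(a)<\pi(d)<\pi(c)$, and call $(p,q)\in D(\pi)$ accessible if $r_{pq}(\pi)\ne0$ and no other box of $D(\pi)$ lies weakly southeast of $(p,q)$. A term order is diagonal if the initial term of each minor of $\mathbf z$ is its diagonal term. A set $G$ of generators of an ideal $J$ is a Gröbner basis if the initial terms of the elements of $G$ generate the initial ideal of $J$. Let $\pi$ be vexillary with accessible box $(p,q)$,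 and let $\prec$ be a diagonal term order on $\Bbbk[\mathbf z]$ such that the essential minors of $I=I_\pi$ form a Gröbner basis of $I$. Put $y=z_{pq}$. Write each essential minor as $g_i=y^{d_i}q_i+r_i$, where $y\nmid q_i$ and $y^{d_i}q_i$ is the initial $y$-form of $g_i$ (the sum of its terms with the highest power of $y$), and let \[ I'=\langle y^{d_i}q_i\rangle_i,\qquad C=\langle q_i\rangle_i,\qquad P=\langle q_i\mid d_i=0\rangle+\langle y\rangle . \] Then the connected component (boxes being adjacent when they share an edge) of $D(\pi)$ containing $(p,q)$ has a northwest corner $(a,b)$, and $(a-1,b-1)=(t,\pi(t))$ for some $t$. Define $\pi_P=\pi\circ(p,\pi^{-1}(q))$ and $\pi_C=\pi_P\circ(t,p)$, where $(i,j)$ denotes a transposition. The following hold. (a) $C=I_{\pi_C}$ and $P=I_{\pi_P}+\langle z_{pq}\rangle$. (b) The generating sets $\{q_i\}$ of $C$ and $\{q_i\mid d_i=0\}\cup\{z_{pq}\}$ of $P$ are Gröbner bases of these ideals under $\prec$. (c) The essential minors of $I_{\pi_C}$ form a Gröbner basis of $I_{\pi_C}$ under $\prec$. (d) $I'=C\cap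 P$ is a geometric vertex decomposition of $I$: the ideal $I'$ is the ideal generated by the initial $y$-forms of all elements of $I$, and $I'=C\cap P$. -/

import Mathlib

open MvPolynomial

noncomputable section

/-! ### Gröbner bases and initial `y`-forms -/

/-- `G` is a Gröbner basis of the ideal `J` under the term order `m`: `G` is contained in `J`,
generates `J`, and its initial terms generate the initial ideal of `J`. -/
def IsGroebnerBasis {σ k : Type*} [Field k] (m : MonomialOrder σ)
    (G : Set (MvPolynomial σ k)) (J : Ideal (MvPolynomial σ k)) : Prop :=
  Ideal.span G = J ∧
    Ideal.span (m.leadingTerm '' (J : Set (MvPolynomial σ k))) =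
      Ideal.span (m.leadingTerm '' G)

/-- The initial `y`-form of `f`: the sum of all terms of `f` with the highest power of `y`. -/
def initForm {σ k : Type*} [Field k] (y : σ) (f : MvPolynomial σ k) : MvPolynomial σ k :=
  ∑ d ∈ f.support with d y = f.degreeOf y, monomial d (f.coeff d)

/-- The polynomial `q` (not divisible by `y` when `f ≠ 0`) such that `y ^ d * q` is the initial
`y`-form of `f`, where `d` is the degree of `f` in `y`. -/
def initCoeff {σ k : Type*} [Field k] (y : σ) (f : MvPolynomial σ k) : MvPolynomial σ k :=
  (initForm y f).divMonomial (Finsupp.single y (f.degreeOf y))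

/-- The ideal generated by the initial `y`-forms of all elements of `J`. -/
def initIdeal {σ k : Type*} [Field k] (y : σ) (J : Ideal (MvPolynomial σ k)) :
    Ideal (MvPolynomial σ k) :=
  Ideal.span (initForm y '' (J : Set (MvPolynomial σ k)))

/-- The generators `y ^ dᵢ * qᵢ` of `I'`, for a set `G` of polynomials `y ^ dᵢ * qᵢ + rᵢ`. -/
def degenGens {σ k : Type*} [Field k] (y : σ) (G : Set (MvPolynomial σ k)) :
    Set (MvPolynomial σ k) :=
  initForm y '' G

/-- The generators `qᵢ` of the cone ideal `C`. -/
def coneGens {σ k : Type*} [Field k] (y : σ) (G : Set (MvPolynomial σ k)) :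
    Set (MvPolynomial σ k) :=
  initCoeff y '' G

/-- The generators of the projection ideal `P`: the `qᵢ` with `dᵢ = 0`, together with `y`. -/
def projGens {σ k : Type*} [Field k] (y : σ) (G : Set (MvPolynomial σ k)) :
    Set (MvPolynomial σ k) :=
  initCoeff y '' {g ∈ G | g.degreeOf y = 0} ∪ {X y}

/-! ### Permutations, diagrams and matrix Schubert varieties

Rows and columns are indexed by `Fin n`, starting at `0`; the dots of `π` are at `(i, π i)`.
The box `(p, q)` stands for the northwest submatrix with last row `p` and last column `q`. -/

/-- The number of dots of `π` weakly northwest of `(p, q)`. -/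
def rankAt {n : ℕ} (π : Equiv.Perm (Fin n)) (p q : Fin n) : ℕ :=
  (Finset.univ.filter fun i : Fin n => i ≤ p ∧ π i ≤ q).card

/-- The diagram of `π`. -/
def diagram {n : ℕ} (π : Equiv.Perm (Fin n)) : Set (Fin n × Fin n) :=
  {b | b.2 < π b.1 ∧ b.1 < π.symm b.2}

/-- The essential set of `π`: boxes of the diagram whose south and east neighbours are not in the
diagram. -/
def essentialSet {n : ℕ} (π : Equiv.Perm (Fin n)) : Set (Fin n × Fin n) :=
  {b | b ∈ diagram π ∧
    (∀ i : Fin n, i.val = b.1.val + 1 → (i, b.2) ∉ diagram π) ∧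
    (∀ j : Fin n, j.val = b.2.val + 1 → (b.1, j) ∉ diagram π)}

/-- `π` is vexillary, that is, 2143-avoiding. -/
def IsVexillary {n : ℕ} (π : Equiv.Perm (Fin n)) : Prop :=
  ¬ ∃ a b c d : Fin n, a < b ∧ b < c ∧ c < d ∧ π b < π a ∧ π a < π d ∧ π d < π c

/-- The box `(p, q)` of the diagram is accessible: its rank is nonzero and no other box of the
diagram lies weakly southeast of it. -/
def IsAccessible {n : ℕ} (π : Equiv.Perm (Fin n)) (p q : Fin n) : Prop :=
  (p, q) ∈ diagram π ∧ rankAt π p q ≠ 0 ∧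
    ∀ i j : Fin n, (i, j) ∈ diagram π → p ≤ i → q ≤ j → (i, j) = (p, q)

/-- Two boxes share an edge. -/
def BoxAdj {n : ℕ} (b c : Fin n × Fin n) : Prop :=
  (b.1 = c.1 ∧ (b.2.val + 1 = c.2.val ∨ c.2.val + 1 = b.2.val)) ∨
    (b.2 = c.2 ∧ (b.1.val + 1 = c.1.val ∨ c.1.val + 1 = b.1.val))

/-- The connected component in the diagram of `π` of the box `b` of the diagram. -/
def diagramComponent {n : ℕ} (π : Equiv.Perm (Fin n)) (b : Fin n × Fin n) :
    Set (Fin n × Fin n) :=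
  {c | Relation.ReflTransGen
    (fun x y => x ∈ diagram π ∧ y ∈ diagram π ∧ BoxAdj x y) b c}

/-- The dot `(t, π t)` is the one adjacent to the northwest corner `(a, b)` of the component of the
diagram that contains `(p, q)`, that is, `(t, π t) = (a - 1, b - 1)`. -/
def IsCornerDot {n : ℕ} (π : Equiv.Perm (Fin n)) (p q t : Fin n) : Prop :=
  ∃ a b : Fin n, (a, b) ∈ diagramComponent π (p, q) ∧
    (∀ c ∈ diagramComponent π (p, q), a ≤ c.1 ∧ b ≤ c.2) ∧
    t.val + 1 = a.val ∧ (π t).val + 1 = b.val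

/-- There is at most one such dot. -/
theorem IsCornerDot.unique {n : ℕ} {π : Equiv.Perm (Fin n)} {p q t t' : Fin n}
    (h : IsCornerDot π p q t) (h' : IsCornerDot π p q t') : t = t' := by
  obtain ⟨a, b, hm, hle, ha, -⟩ := h
  obtain ⟨a', b', hm', hle', ha', -⟩ := h'
  have h1 : a ≤ a' := (hle _ hm').1
  have h2 : a' ≤ a := (hle' _ hm).1
  have h3 : a = a' := le_antisymm h1 h2
  subst h3
  apply Fin.ext
  omega

/-- `π_P = π ∘ (p, π⁻¹ q)`. -/
def permP {n : ℕ} (π : Equiv.Perm (Fin n)) (p q : Fin n) : Equiv.Perm (Fin n) :=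
  π * Equiv.swap p (π.symm q)

/-- `π_C = π_P ∘ (t, p)`. -/
def permC {n : ℕ} (π : Equiv.Perm (Fin n)) (p q t : Fin n) : Equiv.Perm (Fin n) :=
  permP π p q * Equiv.swap t p

/-- The minor of the generic `n × n` matrix `(z i j)` with rows `r` and columns `c`, both listed
in increasing order. -/
def genericMinor (k : Type*) [Field k] {n s : ℕ} (r c : Fin s ↪o Fin n) :
    MvPolynomial (Fin n × Fin n) k :=
  ((Matrix.mvPolynomialX (Fin n) (Fin n) k).submatrix r c).det

/-- The minors of size `1 + rankAt π p q` in the northwest submatrix at `(p, q)`. -/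
def rankMinors (k : Type*) [Field k] {n : ℕ} (π : Equiv.Perm (Fin n)) (p q : Fin n) :
    Set (MvPolynomial (Fin n × Fin n) k) :=
  {f | ∃ r c : Fin (1 + rankAt π p q) ↪o Fin n,
    (∀ a, r a ≤ p) ∧ (∀ a, c a ≤ q) ∧ f = genericMinor k r c}

/-- The Schubert determinantal ideal `I_π`, generated by the minors of all rank conditions. -/
def schubertIdeal (k : Type*) [Field k] {n : ℕ} (π : Equiv.Perm (Fin n)) :
    Ideal (MvPolynomial (Fin n × Fin n) k) :=
  Ideal.span (⋃ (p : Fin n) (q : Fin n), rankMinors k π p q)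

/-- The essential minors of `I_π`: those of the rank conditions at the boxes of the essential
set. -/
def essentialMinors (k : Type*) [Field k] {n : ℕ} (π : Equiv.Perm (Fin n)) :
    Set (MvPolynomial (Fin n × Fin n) k) :=
  ⋃ b ∈ essentialSet π, rankMinors k π b.1 b.2

/-- A diagonal term order: the initial term of each minor of the generic matrix is its diagonal
term. -/
def IsDiagonalOrder (k : Type*) [Field k] {n : ℕ} (m : MonomialOrder (Fin n × Fin n)) : Prop :=
  ∀ (s : ℕ) (r c : Fin s ↪o Fin n),
    m.leadingTerm (genericMinor k r c) = ∏ a : Fin s, X (r a, c a)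

end

/-! Put `y = z_pq` and let `G` be the set of essential minors of `I`. No other box of the diagram
lies weakly southeast of `(p, q)`, so an essential minor can involve `y` only as its southeast
corner entry. It is then linear in `y`, the coefficient of `y` is the minor without its last row and
column, and `y` divides the diagonal term. `LinearInitial` records just this; polynomials outside
`G` need not have initial terms of maximal `y`-degree.

Algebra: a `y`-free `c` in `C` lifts to `y * c + h` in `I` with `h` free of `y` (`exists_lift`).
Hence reduction modulo `G` can go down the powers of `y`, reducing each top coefficient modulo `C`
(`exists_isReduced`). As `0` is the only reduced element of `I`, this shows that `C` has Gröbner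
basis `{q_i}`, that top `y`-coefficients of elements of `I` of positive `y`-degree lie in `C`, and
that `y`-free elements of `I` come from `y`-free generators. Parts (b) and (d) follow.

Combinatorics: by vexillarity the dots northwest of `(p, q)` include one, `(t, π t)`, weakly
southeast of all the others (`exists_isLastDot`). Ranks of `π_P` agree with those of `π` except
southeast of `(p, q)`; ranks of `π_C` are one less than those of `π_P` on the rectangle from `(t, π
t)` to `(p - 1, q - 1)`. There the rank of `π` is constantly `r_pq`, so the new minors have size
`r_pq` and are cofactors of `y` in essential minors. This gives (a) (`span_sep_essentialMinors`,
`span_coneGens`). For (c), the diagonal term of each `q_i` is divisible by that of an essential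
minor of `π_C`. -/

/-! ### Expansion in powers of one variable -/

section Expansion

variable {σ k : Type*} [Field k]

open Classical in
/-- A polynomial, expanded in powers of the variable `y`. -/
noncomputable def yExp (y : σ) : MvPolynomial σ k →ₐ[k] Polynomial (MvPolynomial σ k) :=
  aeval fun i => if i = y then Polynomial.X else Polynomial.C (X i)

theorem yExp_X_self (y : σ) : yExp y (X y : MvPolynomial σ k) = Polynomial.X := by
  simp [yExp]

theorem yExp_X_of_ne {y i : σ} (h : i ≠ y) :
    yExp y (X i : MvPolynomial σ k) = Polynomial.C (X i) := by
  simp [yExp, h]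

theorem yExp_C (y : σ) (c : k) : yExp y (C c) = Polynomial.C (C c) := by
  rw [← MvPolynomial.algebraMap_eq, AlgHom.commutes]; rfl

theorem eval_yExp (y : σ) (f : MvPolynomial σ k) : (yExp y f).eval (X y) = f := by
  induction f using MvPolynomial.induction_on with
  | C a => simp
  | add f g hf hg => simp [hf, hg]
  | mul_X f i hf =>
    rw [map_mul, Polynomial.eval_mul, hf]
    by_cases h : i = y
    · subst h; rw [yExp_X_self, Polynomial.eval_X]
    · rw [yExp_X_of_ne h, Polynomial.eval_C]

theorem yExp_monomial (y : σ) (d : σ →₀ ℕ) (c : k) :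
    yExp y (monomial d c) =
      Polynomial.C (monomial (d.erase y) c) * Polynomial.X ^ d y := by
  classical
  have hfree : ∀ e : σ →₀ ℕ, e y = 0 →
      yExp y (monomial e c) = Polynomial.C (monomial e c) := by
    intro e he
    rw [monomial_eq, map_mul, yExp_C, Finsupp.prod, map_prod, map_mul, map_prod]
    congr 1
    refine Finset.prod_congr rfl fun i hi => ?_
    have : i ≠ y := by rintro rfl; simp [he] at hi
    rw [map_pow, map_pow, yExp_X_of_ne this]
  have h : monomial d c = monomial (d.erase y) c * X y ^ d y := by
    rw [X_pow_eq_monomial, monomial_mul, mul_one, Finsupp.erase_add_single]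
  conv_lhs => rw [h]
  rw [map_mul, map_pow, yExp_X_self, hfree _ (by simp)]

theorem coeff_coeff_yExp (y : σ) (f : MvPolynomial σ k) (j : ℕ) (u : σ →₀ ℕ) :
    coeff u ((yExp y f).coeff j) = if u y = 0 then coeff (u + Finsupp.single y j) f else 0 := by
  classical
  induction f using MvPolynomial.induction_on' with
  | add f g hf hg =>
    rw [map_add, Polynomial.coeff_add, coeff_add, hf, hg, coeff_add]; split_ifs <;> simp
  | monomial d c =>
    rw [yExp_monomial, Polynomial.coeff_C_mul_X_pow]
    have key : (j = d y ∧ d.erase y = u) ↔ (u y = 0 ∧ d = u + Finsupp.single y j) := by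
      constructor
      · rintro ⟨rfl, rfl⟩
        simp [Finsupp.erase_add_single]
      · rintro ⟨h, rfl⟩
        refine ⟨by simp [h], ?_⟩
        ext i
        by_cases hi : i = y
        · subst hi; simp [h]
        · simp [hi]
    rw [apply_ite (coeff u), coeff_monomial, coeff_monomial, coeff_zero, ← ite_and, ← ite_and]
    exact if_congr key rfl rfl

theorem natDegree_yExp (y : σ) (f : MvPolynomial σ k) :
    (yExp y f).natDegree = f.degreeOf y := by
  classical
  apply eq_of_forall_ge_iff
  intro e
  rw [Polynomial.natDegree_le_iff_coeff_eq_zero, degreeOf_le_iff]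
  constructor
  · intro h d hd
    by_contra! hlt
    have h1 := congrArg (coeff (d.erase y)) (h _ hlt)
    rw [coeff_coeff_yExp, if_pos (by simp), Finsupp.erase_add_single] at h1
    exact (mem_support_iff.mp hd) (by simpa using h1)
  · intro h N hN
    ext u
    rw [coeff_coeff_yExp, coeff_zero]
    split_ifs with hu
    · by_contra hne
      have := h _ (mem_support_iff.mpr hne)
      simp [hu] at this
      omega
    · rfl

theorem yExp_of_degreeOf_eq_zero {y : σ} {f : MvPolynomial σ k} (h : f.degreeOf y = 0) :
    yExp y f = Polynomial.C f := by
  have h1 := Polynomial.eq_C_of_natDegree_eq_zero ((natDegree_yExp y f).trans h)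
  have h2 := eval_yExp y f
  rw [h1, Polynomial.eval_C] at h2
  rw [h1, h2]

theorem degreeOf_eq_zero_of_yExp {y : σ} {f g : MvPolynomial σ k}
    (h : yExp y f = Polynomial.C g) : f.degreeOf y = 0 := by
  rw [← natDegree_yExp, h, Polynomial.natDegree_C]

theorem degreeOf_coeff_yExp (y : σ) (f : MvPolynomial σ k) (j : ℕ) :
    ((yExp y f).coeff j).degreeOf y = 0 := by
  rw [← Nat.le_zero, degreeOf_le_iff]
  intro u hu
  rw [mem_support_iff, coeff_coeff_yExp] at hu
  by_contra h
  exact hu (if_neg (by omega))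

theorem degreeOf_mul_eq_zero {y : σ} {f g : MvPolynomial σ k} (hf : f.degreeOf y = 0)
    (hg : g.degreeOf y = 0) : (f * g).degreeOf y = 0 := by
  have := degreeOf_mul_le y f g
  omega

theorem degreeOf_add_eq_zero {y : σ} {f g : MvPolynomial σ k} (hf : f.degreeOf y = 0)
    (hg : g.degreeOf y = 0) : (f + g).degreeOf y = 0 := by
  have := degreeOf_add_le y f g
  omega

theorem degreeOf_sub_eq_zero {y : σ} {f g : MvPolynomial σ k} (hf : f.degreeOf y = 0)
    (hg : g.degreeOf y = 0) : (f - g).degreeOf y = 0 := by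
  have := degreeOf_sub_le y f g
  omega

theorem coeff_zero_yExp_of_degreeOf {y : σ} {f : MvPolynomial σ k} (h : f.degreeOf y = 0) :
    (yExp y f).coeff 0 = f := by
  rw [yExp_of_degreeOf_eq_zero h, Polynomial.coeff_C_zero]

/-! ### Initial `y`-forms and leading `y`-coefficients. -/

theorem initCoeff_eq (y : σ) (f : MvPolynomial σ k) :
    initCoeff y f = (yExp y f).coeff (f.degreeOf y) := by
  classical
  ext u
  rw [coeff_coeff_yExp, initCoeff, coeff_divMonomial, initForm, coeff_sum]
  simp only [coeff_monomial]
  rw [Finset.sum_ite_eq', add_comm u]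
  by_cases hu : u y = 0
  · by_cases h : coeff (Finsupp.single y (f.degreeOf y) + u) f = 0 <;> simp [hu, h]
  · simp [hu]

theorem initForm_eq (y : σ) (f : MvPolynomial σ k) :
    initForm y f = X y ^ f.degreeOf y * initCoeff y f := by
  classical
  ext u
  rw [X_pow_eq_monomial, coeff_monomial_mul', initCoeff, coeff_divMonomial]
  split_ifs with h
  · rw [one_mul, add_tsub_cancel_of_le h]
  · rw [initForm, coeff_sum]
    simp only [coeff_monomial]
    rw [Finset.sum_ite_eq', if_neg]
    intro hu
    rw [Finset.mem_filter] at hu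
    refine h ?_
    rw [Finsupp.single_le_iff, hu.2]

theorem degreeOf_initCoeff (y : σ) (f : MvPolynomial σ k) : (initCoeff y f).degreeOf y = 0 := by
  rw [initCoeff_eq]; exact degreeOf_coeff_yExp y f _

theorem initCoeff_of_degreeOf {y : σ} {f : MvPolynomial σ k} (h : f.degreeOf y = 0) :
    initCoeff y f = f := by
  rw [initCoeff_eq, h, coeff_zero_yExp_of_degreeOf h]

theorem eq_of_degreeOf_eq_one {y : σ} {f : MvPolynomial σ k} (h : f.degreeOf y = 1) :
    f = X y * initCoeff y f + (yExp y f).coeff 0 := by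
  have h1 := Polynomial.eq_X_add_C_of_natDegree_le_one (((natDegree_yExp y f).trans h).le)
  have h2 := eval_yExp y f
  rw [h1] at h2
  rw [initCoeff_eq, h]
  rw [Polynomial.eval_add, Polynomial.eval_mul, Polynomial.eval_C, Polynomial.eval_X,
    Polynomial.eval_C, mul_comm] at h2
  exact h2.symm

theorem exists_eq_initForm_add {y : σ} {f : MvPolynomial σ k} {e : ℕ}
    (h : f.degreeOf y ≤ e + 1) : ∃ l : MvPolynomial σ k, l.degreeOf y ≤ e ∧
      f = X y ^ (e + 1) * (yExp y f).coeff (e + 1) + l := by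
  have hX : yExp y (X y ^ (e + 1) * (yExp y f).coeff (e + 1)) =
      Polynomial.C ((yExp y f).coeff (e + 1)) * Polynomial.X ^ (e + 1) := by
    rw [map_mul, map_pow, yExp_X_self, yExp_of_degreeOf_eq_zero (degreeOf_coeff_yExp y f _),
      mul_comm]
  refine ⟨f - X y ^ (e + 1) * (yExp y f).coeff (e + 1), ?_, by ring⟩
  rw [← natDegree_yExp, Polynomial.natDegree_le_iff_coeff_eq_zero, map_sub, hX]
  intro N hN
  rw [Polynomial.coeff_sub, Polynomial.coeff_C_mul_X_pow]
  split_ifs with h'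
  · rw [h', sub_self]
  · rw [sub_zero, Polynomial.coeff_eq_zero_of_natDegree_lt]
    rw [natDegree_yExp]; omega

theorem support_coeff_yExp_zero_subset (y : σ) (f : MvPolynomial σ k) :
    ((yExp y f).coeff 0).support ⊆ f.support := by
  intro u hu
  rw [mem_support_iff, coeff_coeff_yExp] at hu
  rw [mem_support_iff]
  intro h
  apply hu
  rw [Finsupp.single_zero, add_zero, h, ite_self]

/-- An ideal with `y`-free generators is homogeneous for the grading by powers of `y`. -/
theorem coeff_yExp_mem_span {y : σ} {G : Set (MvPolynomial σ k)}
    (hG : ∀ g ∈ G, g.degreeOf y = 0) {f : MvPolynomial σ k} (hf : f ∈ Ideal.span G) (j : ℕ) :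
    (yExp y f).coeff j ∈ Ideal.span G := by
  induction hf using Submodule.span_induction generalizing j with
  | mem g hg =>
    rw [yExp_of_degreeOf_eq_zero (hG g hg), Polynomial.coeff_C]
    split_ifs
    · exact Ideal.subset_span hg
    · exact Ideal.zero_mem _
  | zero => simp
  | add f g _ _ hf hg =>
    rw [map_add, Polynomial.coeff_add]; exact Ideal.add_mem _ (hf j) (hg j)
  | smul a f _ hf =>
    rw [smul_eq_mul, map_mul, Polynomial.coeff_mul]
    exact Ideal.sum_mem _ fun x _ => Ideal.mul_mem_left _ _ (hf _)

end Expansion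

/-! ### Gröbner bases and division -/

section Groebner

variable {σ k : Type*} [Field k] {m : MonomialOrder σ}

theorem leadingTerm_mem_span_iff {G : Set (MvPolynomial σ k)} (h0 : (0 : MvPolynomial σ k) ∉ G)
    {f : MvPolynomial σ k} (hf : f ≠ 0) :
    m.leadingTerm f ∈ Ideal.span (m.leadingTerm '' G) ↔ ∃ g ∈ G, m.degree g ≤ m.degree f := by
  rw [MonomialOrder.span_leadingTerm_eq_span_monomial', Set.sdiff_singleton_eq_self h0,
    ← Set.image_image (fun s => monomial s (1 : k)) m.degree G, mem_ideal_span_monomial_image]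
  simp [m.support_leadingTerm' hf]

theorem IsGroebnerBasis.exists_degree_le {G : Set (MvPolynomial σ k)}
    {J : Ideal (MvPolynomial σ k)} (h : IsGroebnerBasis m G J)
    (h0 : (0 : MvPolynomial σ k) ∉ G) {f : MvPolynomial σ k} (hfJ : f ∈ J) (hf : f ≠ 0) :
    ∃ g ∈ G, m.degree g ≤ m.degree f := by
  rw [← leadingTerm_mem_span_iff h0 hf, ← h.2]
  exact Ideal.subset_span ⟨f, hfJ, rfl⟩

theorem isGroebnerBasis_of_exists_degree_le {G : Set (MvPolynomial σ k)}
    {J : Ideal (MvPolynomial σ k)} (hJ : Ideal.span G = J) (h0 : (0 : MvPolynomial σ k) ∉ G)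
    (h : ∀ f ∈ J, f ≠ 0 → ∃ g ∈ G, m.degree g ≤ m.degree f) : IsGroebnerBasis m G J := by
  refine ⟨hJ, le_antisymm ?_ ?_⟩
  · rw [Ideal.span_le]
    rintro _ ⟨f, hf, rfl⟩
    by_cases hf0 : f = 0
    · simp [hf0]
    · exact (leadingTerm_mem_span_iff h0 hf0).mpr (h f hf hf0)
  · refine Ideal.span_mono (Set.image_mono ?_)
    rw [← hJ]
    exact Ideal.subset_span

/-- No term of `f` is divisible by the initial term of an element of `G`. -/
def IsReducedModulo (m : MonomialOrder σ) (G : Set (MvPolynomial σ k)) (f : MvPolynomial σ k) : Prop :=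
  ∀ u ∈ f.support, ∀ g ∈ G, ¬ m.degree g ≤ u

theorem IsReducedModulo.add {G : Set (MvPolynomial σ k)} {f g : MvPolynomial σ k}
    (hf : IsReducedModulo m G f) (hg : IsReducedModulo m G g) : IsReducedModulo m G (f + g) := by
  classical
  intro u hu
  rcases Finset.mem_union.mp (support_add hu) with h | h
  · exact hf u h
  · exact hg u h

theorem IsGroebnerBasis.eq_zero_of_isReduced {G : Set (MvPolynomial σ k)}
    {J : Ideal (MvPolynomial σ k)} (h : IsGroebnerBasis m G J)
    (h0 : (0 : MvPolynomial σ k) ∉ G) {f : MvPolynomial σ k} (hfJ : f ∈ J)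
    (hf : IsReducedModulo m G f) : f = 0 := by
  by_contra hne
  obtain ⟨g, hg, hle⟩ := h.exists_degree_le h0 hfJ hne
  exact hf _ (m.degree_mem_support hne) g hg hle

/-- Division of `f` leaves a reduced remainder in the ideal, hence `0`. The leading monomial of `f`
then occurs in some product `b * a b`, and division bounds the degree of this product by that of
`f`, so both have the same leading monomial. -/
theorem isGroebnerBasis_span_of_isReducedModulo {G : Set (MvPolynomial σ k)}
    (h0 : (0 : MvPolynomial σ k) ∉ G)
    (h : ∀ s ∈ Ideal.span G, IsReducedModulo m G s → s = 0) :
    IsGroebnerBasis m G (Ideal.span G) := by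
  refine isGroebnerBasis_of_exists_degree_le rfl h0 fun f hf hne => ?_
  have hu : ∀ b ∈ G, IsUnit (m.leadingCoeff b) := fun b hb =>
    (m.leadingCoeff_ne_zero_iff.mpr (ne_of_mem_of_not_mem hb h0)).isUnit
  obtain ⟨a, s, hs, hd, hr⟩ := m.div_set hu f
  have hsum : f - s ∈ Ideal.span G := by
    rw [hs, add_sub_cancel_right, Finsupp.linearCombination_apply]
    exact Ideal.sum_mem _ fun b _ => Ideal.mul_mem_left _ _ (Ideal.subset_span b.2)
  have hs0 : s = 0 := h s (by simpa using Ideal.sub_mem _ hf hsum) hr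
  rw [hs0, add_zero, Finsupp.linearCombination_apply, Finsupp.sum] at hs
  have hc : coeff (m.degree f) f ≠ 0 := mem_support_iff.mp (m.degree_mem_support hne)
  have hc' := congrArg (coeff (m.degree f)) hs
  rw [coeff_sum] at hc'
  obtain ⟨b, -, hb⟩ := Finset.exists_ne_zero_of_sum_ne_zero fun h => hc (hc'.trans h)
  rw [smul_eq_mul, mul_comm] at hb
  have heq : m.degree ((b : MvPolynomial σ k) * a b) = m.degree f :=
    m.toSyn.injective (le_antisymm (hd b) (m.le_degree (mem_support_iff.mpr hb)))
  have hba : (b : MvPolynomial σ k) * a b ≠ 0 := by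
    intro h
    rw [h, coeff_zero] at hb
    exact hb rfl
  refine ⟨b, b.2, ?_⟩
  rw [← heq, m.degree_mul' hba]
  exact le_self_add

theorem exists_isReduced_sub_mem {y : σ} {G : Set (MvPolynomial σ k)}
    (h0 : (0 : MvPolynomial σ k) ∉ G) (hG : ∀ g ∈ G, g.degreeOf y = 0) {f : MvPolynomial σ k}
    (hf : f.degreeOf y = 0) :
    ∃ s, f - s ∈ Ideal.span G ∧ s.degreeOf y = 0 ∧ IsReducedModulo m G s := by
  have hu : ∀ b ∈ G, IsUnit (m.leadingCoeff b) := fun b hb =>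
    (m.leadingCoeff_ne_zero_iff.mpr (ne_of_mem_of_not_mem hb h0)).isUnit
  obtain ⟨a, s, hs, -, hr⟩ := m.div_set hu f
  -- Dropping the terms of the remainder that involve `y` only shrinks its support, so it stays
  -- reduced; membership survives because the generators are `y`-free.
  refine ⟨(yExp y s).coeff 0, ?_, degreeOf_coeff_yExp y s 0,
    fun u h => hr u (support_coeff_yExp_zero_subset y s h)⟩
  have hmem : f - s ∈ Ideal.span G := by
    rw [hs, add_sub_cancel_right, Finsupp.linearCombination_apply]
    exact Ideal.sum_mem _ fun b _ => Ideal.mul_mem_left _ _ (Ideal.subset_span b.2)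
  have h := coeff_yExp_mem_span hG hmem 0
  rwa [map_sub, Polynomial.coeff_sub, coeff_zero_yExp_of_degreeOf hf] at h

end Groebner

/-! ### Vertex decompositions from Gröbner bases -/

/-- The initial terms of the elements of `G` come from their initial `y`-forms, which are at most
linear in `y`. -/
structure LinearInitial {σ k : Type*} [Field k] (m : MonomialOrder σ) (y : σ)
    (G : Set (MvPolynomial σ k)) : Prop where
  zero_notMem : (0 : MvPolynomial σ k) ∉ G
  degreeOf_le : ∀ g ∈ G, g.degreeOf y ≤ 1
  degree_apply : ∀ g ∈ G, m.degree g y = g.degreeOf y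

namespace LinearInitial

variable {σ k : Type*} [Field k] {m : MonomialOrder σ} {y : σ} {G : Set (MvPolynomial σ k)}
  {J : Ideal (MvPolynomial σ k)}

theorem initCoeff_ne_zero (hG : LinearInitial m y G) {g : MvPolynomial σ k} (hg : g ∈ G) :
    initCoeff y g ≠ 0 := by
  rw [initCoeff_eq, ← natDegree_yExp]
  refine Polynomial.leadingCoeff_ne_zero.mpr fun h => ?_
  have h2 := eval_yExp y g
  rw [h, Polynomial.eval_zero] at h2
  exact hG.zero_notMem (h2 ▸ hg)

/-- The leading monomial of `g` has the maximal power of `y`, so it survives in the initial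
`y`-form. -/
theorem degree_eq (hG : LinearInitial m y G) {g : MvPolynomial σ k} (hg : g ∈ G) :
    m.degree g = Finsupp.single y (g.degreeOf y) + m.degree (initCoeff y g) := by
  classical
  have hne : g ≠ 0 := ne_of_mem_of_not_mem hg hG.zero_notMem
  have hc : ∀ u, coeff u (initForm y g) = if u y = g.degreeOf y then coeff u g else 0 := by
    intro u
    rw [initForm, coeff_sum]
    simp only [coeff_monomial]
    rw [Finset.sum_ite_eq']
    by_cases h1 : coeff u g = 0 <;> simp [h1]
  have h1 : m.degree (initForm y g) = m.degree g := by
    apply m.toSyn.injective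
    apply le_antisymm
    · refine m.degree_le_degree_of_support_subset fun u hu => ?_
      rw [mem_support_iff, hc] at hu
      rw [mem_support_iff]
      intro h
      simp [h] at hu
    · refine m.le_degree ?_
      rw [mem_support_iff, hc, if_pos (hG.degree_apply g hg)]
      exact mem_support_iff.mp (m.degree_mem_support hne)
  rw [← h1, initForm_eq, X_pow_eq_monomial,
    m.degree_mul (by simp) (hG.initCoeff_ne_zero hg), m.degree_monomial, if_neg one_ne_zero]

theorem zero_notMem_coneGens (hG : LinearInitial m y G) :
    (0 : MvPolynomial σ k) ∉ coneGens y G := by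
  rintro ⟨g, hg, h⟩
  exact hG.initCoeff_ne_zero hg h

theorem degreeOf_of_mem_coneGens {q : MvPolynomial σ k} (h : q ∈ coneGens y G) :
    q.degreeOf y = 0 := by
  obtain ⟨g, -, rfl⟩ := h
  exact degreeOf_initCoeff y g

/-- The constant coefficient in `y` replaces `c` itself because multipliers in the span may involve
`y`. Taking this coefficient is a ring homomorphism, so the induction goes through with `h` free of
`y`. -/
theorem exists_lift (hG : LinearInitial m y G) {c : MvPolynomial σ k}
    (hc : c ∈ Ideal.span (coneGens y G)) :
    ∃ h : MvPolynomial σ k, h.degreeOf y = 0 ∧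
      X y * (yExp y c).coeff 0 + h ∈ Ideal.span G := by
  induction hc using Submodule.span_induction with
  | mem q hq =>
    obtain ⟨g, hg, rfl⟩ := hq
    rw [coeff_zero_yExp_of_degreeOf (degreeOf_initCoeff y g)]
    rcases Nat.le_one_iff_eq_zero_or_eq_one.mp (hG.degreeOf_le g hg) with h | h
    · refine ⟨0, by simp, ?_⟩
      rw [initCoeff_of_degreeOf h, add_zero]
      exact Ideal.mul_mem_left _ _ (Ideal.subset_span hg)
    · exact ⟨_, degreeOf_coeff_yExp y g 0, eq_of_degreeOf_eq_one h ▸ Ideal.subset_span hg⟩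
  | zero => exact ⟨0, by simp, by simp⟩
  | add c d _ _ hc hd =>
    obtain ⟨h, hh, hm⟩ := hc
    obtain ⟨h', hh', hm'⟩ := hd
    refine ⟨h + h', degreeOf_add_eq_zero hh hh', ?_⟩
    rw [map_add, Polynomial.coeff_add]
    convert Ideal.add_mem _ hm hm' using 1
    ring
  | smul a c _ hc =>
    obtain ⟨h, hh, hm⟩ := hc
    refine ⟨(yExp y a).coeff 0 * h, degreeOf_mul_eq_zero (degreeOf_coeff_yExp y a 0) hh, ?_⟩
    rw [smul_eq_mul, map_mul, Polynomial.mul_coeff_zero]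
    convert Ideal.mul_mem_left _ ((yExp y a).coeff 0) hm using 1
    ring

theorem isReduced_X_pow_mul (hG : LinearInitial m y G) {s : MvPolynomial σ k}
    (hs0 : s.degreeOf y = 0) (hs : IsReducedModulo m (coneGens y G) s) (e : ℕ) :
    IsReducedModulo m G (X y ^ e * s) := by
  classical
  intro u hu g hg hle
  rw [mem_support_iff, X_pow_eq_monomial, coeff_monomial_mul', one_mul] at hu
  split_ifs at hu with hle'
  · have hu' := mem_support_iff.mpr hu
    refine hs _ hu' _ ⟨g, hg, rfl⟩ fun i => ?_
    by_cases hi : i = y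
    · subst hi
      have := degreeOf_le_iff.mp (degreeOf_initCoeff i g).le _
        (m.degree_mem_support (hG.initCoeff_ne_zero hg))
      omega
    · have := hle i
      rw [hG.degree_eq hg] at this
      simpa [Finsupp.single_apply, Ne.symm hi] using this
  · exact hu rfl

theorem isReduced_of_degreeOf (hG : LinearInitial m y G) {s : MvPolynomial σ k}
    (hs0 : s.degreeOf y = 0) (hs : IsReducedModulo m {g ∈ G | g.degreeOf y = 0} s) :
    IsReducedModulo m G s := by
  intro u hu g hg hle
  have h1 : u y = 0 := by
    have := (degreeOf_le_iff.mp hs0.le) u hu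
    omega
  have h2 := hle y
  rw [hG.degree_apply g hg, h1] at h2
  exact hs u hu g ⟨hg, Nat.le_zero.mp h2⟩ hle

/-- Normal forms modulo `G` that respect the filtration by `y`-degree. The clauses for `e = 0` and
`e ≠ 0` control the top coefficient; they are what remains useful when `f` lies in `J` and `s`
vanishes. -/
theorem exists_isReduced (hG : LinearInitial m y G) (e : ℕ) {f : MvPolynomial σ k}
    (hf : f.degreeOf y ≤ e) :
    ∃ s, f - s ∈ Ideal.span G ∧ IsReducedModulo m G s ∧
      (e = 0 → f - s ∈ Ideal.span {g ∈ G | g.degreeOf y = 0}) ∧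
      (e ≠ 0 → (yExp y f).coeff e - (yExp y s).coeff e ∈ Ideal.span (coneGens y G)) ∧
      s.degreeOf y ≤ e := by
  induction e generalizing f with
  | zero =>
    obtain ⟨s, hs, hs0, hr⟩ := exists_isReduced_sub_mem (m := m) (y := y)
      (G := {g ∈ G | g.degreeOf y = 0}) (fun h => hG.zero_notMem h.1) (fun g hg => hg.2)
      (Nat.le_zero.mp hf)
    exact ⟨s, Ideal.span_mono (Set.sep_subset _ _) hs, hG.isReduced_of_degreeOf hs0 hr,
      fun _ => hs, fun h => absurd rfl h, hs0.le⟩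
  | succ e ih =>
    obtain ⟨l, hl, hfl⟩ := exists_eq_initForm_add hf
    set c := (yExp y f).coeff (e + 1)
    have hc : c.degreeOf y = 0 := degreeOf_coeff_yExp y f _
    obtain ⟨s, hs, hs0, hr⟩ := exists_isReduced_sub_mem (m := m) (y := y)
      hG.zero_notMem_coneGens (fun q hq => degreeOf_of_mem_coneGens hq) hc
    -- Replacing `y ^ (e + 1) * c` by `y ^ (e + 1) * s` costs `-y ^ e * h` modulo `G`, which has
    -- `y`-degree at most `e` and is passed to the induction together with `l`.
    obtain ⟨h, hh, hm⟩ := hG.exists_lift hs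
    rw [coeff_zero_yExp_of_degreeOf (degreeOf_sub_eq_zero hc hs0)] at hm
    have hX : (X y ^ e : MvPolynomial σ k).degreeOf y ≤ e := by
      rw [← natDegree_yExp, map_pow, yExp_X_self, Polynomial.natDegree_X_pow]
    have hl' : (l - X y ^ e * h).degreeOf y ≤ e := by
      refine (degreeOf_sub_le _ _ _).trans (max_le hl ((degreeOf_mul_le _ _ _).trans ?_))
      omega
    obtain ⟨s', hs', hr', -, -, hd'⟩ := ih hl'
    have hXs : yExp y (X y ^ (e + 1) * s) = Polynomial.C s * Polynomial.X ^ (e + 1) := by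
      rw [map_mul, map_pow, yExp_X_self, yExp_of_degreeOf_eq_zero hs0, mul_comm]
    refine ⟨X y ^ (e + 1) * s + s', ?_, (hG.isReduced_X_pow_mul hs0 hr _).add hr',
      fun h => absurd h (Nat.succ_ne_zero e), fun _ => ?_, ?_⟩
    · have : f - (X y ^ (e + 1) * s + s') =
          X y ^ e * (X y * (c - s) + h) + (l - X y ^ e * h - s') := by
        rw [hfl]; ring
      rw [this]
      exact Ideal.add_mem _ (Ideal.mul_mem_left _ _ hm) hs'
    · have h1 : (yExp y s').coeff (e + 1) = 0 := by
        apply Polynomial.coeff_eq_zero_of_natDegree_lt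
        rw [natDegree_yExp]; omega
      rw [map_add, Polynomial.coeff_add, h1, add_zero, hXs, Polynomial.coeff_C_mul_X_pow,
        if_pos rfl]
      exact hs
    · refine (degreeOf_add_le _ _ _).trans (max_le ?_ (by omega))
      rw [← natDegree_yExp, hXs]
      exact Polynomial.natDegree_C_mul_X_pow_le _ _

theorem eq_zero_of_isReduced (hG : LinearInitial m y G) (hJ : IsGroebnerBasis m G J)
    {s : MvPolynomial σ k} (hs0 : s.degreeOf y = 0) (hs : s ∈ Ideal.span (coneGens y G))
    (hr : IsReducedModulo m (coneGens y G) s) : s = 0 := by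
  obtain ⟨h, hh, hm⟩ := hG.exists_lift hs
  rw [coeff_zero_yExp_of_degreeOf hs0] at hm
  obtain ⟨h', hm', hr', -, -, hd'⟩ := hG.exists_isReduced 0 hh.le
  -- Both summands are reduced modulo `G` and the sum lies in `J`; comparing coefficients of `y`
  -- then kills `s`.
  have hz : X y * s + h' = 0 := by
    refine hJ.eq_zero_of_isReduced hG.zero_notMem ?_ (IsReducedModulo.add ?_ hr')
    · rw [← hJ.1]
      convert Ideal.sub_mem _ hm hm' using 1
      ring
    · simpa using hG.isReduced_X_pow_mul hs0 hr 1
  have h2 := congrArg (fun f => (yExp y f).coeff 1) hz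
  simpa [yExp_X_self, yExp_of_degreeOf_eq_zero hs0,
    yExp_of_degreeOf_eq_zero (Nat.le_zero.mp hd'), Polynomial.coeff_C] using h2

theorem isGroebnerBasis_coneGens (hG : LinearInitial m y G) (hJ : IsGroebnerBasis m G J) :
    IsGroebnerBasis m (coneGens y G) (Ideal.span (coneGens y G)) := by
  refine isGroebnerBasis_span_of_isReducedModulo hG.zero_notMem_coneGens fun s hs hr => ?_
  have hj : ∀ j, (yExp y s).coeff j = 0 := by
    intro j
    refine hG.eq_zero_of_isReduced hJ (degreeOf_coeff_yExp y s j)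
      (coeff_yExp_mem_span (fun q hq => degreeOf_of_mem_coneGens hq) hs j) fun u hu q hq hle => ?_
    rw [mem_support_iff, coeff_coeff_yExp] at hu
    split_ifs at hu with h
    · exact hr _ (mem_support_iff.mpr hu) q hq (hle.trans le_self_add)
    · exact hu rfl
  rw [← eval_yExp y s, show yExp y s = 0 from Polynomial.ext hj, Polynomial.eval_zero]

theorem mem_span_of_degreeOf (hG : LinearInitial m y G) (hJ : IsGroebnerBasis m G J)
    {f : MvPolynomial σ k} (hf : f ∈ J) (h0 : f.degreeOf y = 0) :
    f ∈ Ideal.span {g ∈ G | g.degreeOf y = 0} := by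
  obtain ⟨s, hs, hr, h, -, -⟩ := hG.exists_isReduced 0 h0.le
  have hs0 : s = 0 := by
    refine hJ.eq_zero_of_isReduced hG.zero_notMem ?_ hr
    rw [← hJ.1] at hf ⊢
    simpa using Ideal.sub_mem _ hf hs
  simpa [hs0] using h rfl

/-- One factor `y` suffices because every `d_i` is at most `1`. -/
theorem X_mul_mem_span_degenGens (hG : LinearInitial m y G) {c : MvPolynomial σ k}
    (hc : c ∈ Ideal.span (coneGens y G)) : X y * c ∈ Ideal.span (degenGens y G) := by
  induction hc using Submodule.span_induction with
  | mem q hq =>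
    obtain ⟨g, hg, rfl⟩ := hq
    have hmem : initForm y g ∈ Ideal.span (degenGens y G) := Ideal.subset_span ⟨g, hg, rfl⟩
    rw [initForm_eq] at hmem
    rcases Nat.le_one_iff_eq_zero_or_eq_one.mp (hG.degreeOf_le g hg) with h | h
    · rw [h, pow_zero, one_mul] at hmem
      exact Ideal.mul_mem_left _ _ hmem
    · rwa [h, pow_one] at hmem
  | zero => simp
  | add c d _ _ hc hd => rw [mul_add]; exact Ideal.add_mem _ hc hd
  | smul a c _ hc => rw [smul_eq_mul, mul_left_comm]; exact Ideal.mul_mem_left _ _ hc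

theorem span_sep_le_span_degenGens :
    Ideal.span {g ∈ G | g.degreeOf y = 0} ≤ Ideal.span (degenGens y G) := by
  rw [Ideal.span_le]
  rintro g ⟨hg, h⟩
  refine Ideal.subset_span ⟨g, hg, ?_⟩
  rw [initForm_eq, h, pow_zero, one_mul, initCoeff_of_degreeOf h]

theorem initIdeal_eq (hG : LinearInitial m y G) (hJ : IsGroebnerBasis m G J) :
    initIdeal y J = Ideal.span (degenGens y G) := by
  apply le_antisymm
  · rw [initIdeal, Ideal.span_le]
    rintro _ ⟨f, hf, rfl⟩
    have hf : f ∈ J := hf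
    rw [SetLike.mem_coe, initForm_eq]
    rcases hd : f.degreeOf y with _ | e
    · rw [pow_zero, one_mul, initCoeff_of_degreeOf hd]
      exact span_sep_le_span_degenGens (hG.mem_span_of_degreeOf hJ hf hd)
    · obtain ⟨s, hs, hr, -, h, -⟩ := hG.exists_isReduced (e + 1) hd.le
      have hs0 : s = 0 := by
        refine hJ.eq_zero_of_isReduced hG.zero_notMem ?_ hr
        rw [← hJ.1] at hf ⊢
        simpa using Ideal.sub_mem _ hf hs
      have h' := h (Nat.succ_ne_zero e)
      rw [hs0, map_zero, Polynomial.coeff_zero, sub_zero] at h'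
      rw [initCoeff_eq, hd, pow_succ, mul_assoc]
      exact Ideal.mul_mem_left _ _ (hG.X_mul_mem_span_degenGens h')
  · refine Ideal.span_mono (Set.image_mono ?_)
    rw [← hJ.1]
    exact Ideal.subset_span

theorem initCoeff_image_sep :
    initCoeff y '' {g ∈ G | g.degreeOf y = 0} = {g ∈ G | g.degreeOf y = 0} := by
  refine (Set.image_congr fun g hg => initCoeff_of_degreeOf hg.2).trans (Set.image_id' _)

theorem span_projGens : Ideal.span (projGens y G) =
    Ideal.span {g ∈ G | g.degreeOf y = 0} ⊔ Ideal.span {X y} := by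
  rw [projGens, Ideal.span_union, initCoeff_image_sep]

theorem span_degenGens_eq_inf (hG : LinearInitial m y G) :
    Ideal.span (degenGens y G) =
      Ideal.span (coneGens y G) ⊓ Ideal.span (projGens y G) := by
  apply le_antisymm
  · rw [Ideal.span_le]
    rintro _ ⟨g, hg, rfl⟩
    rw [SetLike.mem_coe, initForm_eq]
    refine ⟨Ideal.mul_mem_left _ _ (Ideal.subset_span ⟨g, hg, rfl⟩), ?_⟩
    rcases Nat.le_one_iff_eq_zero_or_eq_one.mp (hG.degreeOf_le g hg) with h | h
    · exact Ideal.mul_mem_left _ _ (Ideal.subset_span (Or.inl ⟨g, ⟨hg, h⟩, rfl⟩))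
    · rw [h, pow_one]
      exact Ideal.mul_mem_right _ _ (Ideal.subset_span (Or.inr rfl))
  · rintro f ⟨hC, hP⟩
    have hC : f ∈ Ideal.span (coneGens y G) := hC
    have hP : f ∈ Ideal.span (projGens y G) := hP
    rw [span_projGens] at hP
    obtain ⟨h, hh, z, hz, rfl⟩ := Submodule.mem_sup.mp hP
    obtain ⟨a, rfl⟩ := Ideal.mem_span_singleton'.mp hz
    have hhI := span_sep_le_span_degenGens hh
    -- With `f = h + a * y` and `h` in both `I'` and `C`, it remains to treat `a * y`, which lies in
    -- `C`. As `C` has `y`-free generators, `a` lies in `C`, and `y * C` is contained in `I'`.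
    refine Ideal.add_mem _ hhI ?_
    have hhC : h ∈ Ideal.span (coneGens y G) := by
      refine Ideal.span_mono ?_ hh
      rintro g ⟨hg, h0⟩
      exact ⟨g, hg, initCoeff_of_degreeOf h0⟩
    have haX : a * X y ∈ Ideal.span (coneGens y G) := by
      simpa using Ideal.sub_mem _ hC hhC
    rw [mul_comm]
    refine hG.X_mul_mem_span_degenGens ?_
    have hj : ∀ j, (yExp y a).coeff j ∈ Ideal.span (coneGens y G) := by
      intro j
      have := coeff_yExp_mem_span (fun q hq => degreeOf_of_mem_coneGens hq) haX (j + 1)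
      rwa [map_mul, yExp_X_self, Polynomial.coeff_mul_X] at this
    rw [← eval_yExp y a, Polynomial.eval_eq_sum_range]
    exact Ideal.sum_mem _ fun j _ => Ideal.mul_mem_right _ _ (hj j)

/-- If `y` divides the leading monomial of `f`, the generator `y` serves. Otherwise this monomial
also leads the `y`-free part of `f`, which lies in `J`, and a generator whose leading monomial
divides it must be `y`-free. -/
theorem isGroebnerBasis_projGens (hG : LinearInitial m y G) (hJ : IsGroebnerBasis m G J) :
    IsGroebnerBasis m (projGens y G) (Ideal.span (projGens y G)) := by
  refine isGroebnerBasis_of_exists_degree_le rfl ?_ fun f hf hne => ?_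
  · rintro (⟨g, hg, h⟩ | h)
    · exact hG.initCoeff_ne_zero hg.1 h
    · exact X_ne_zero y h.symm
  by_cases hu : m.degree f y = 0
  · have h0 : (yExp y f).coeff 0 ∈ Ideal.span {g ∈ G | g.degreeOf y = 0} := by
      rw [span_projGens] at hf
      obtain ⟨h, hh, z, hz, rfl⟩ := Submodule.mem_sup.mp hf
      obtain ⟨a, rfl⟩ := Ideal.mem_span_singleton'.mp hz
      rw [map_add, map_mul, yExp_X_self, Polynomial.coeff_add, Polynomial.coeff_mul_X_zero,
        add_zero]
      exact coeff_yExp_mem_span (fun g hg => hg.2) hh 0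
    have hmem : m.degree f ∈ ((yExp y f).coeff 0).support := by
      rw [mem_support_iff, coeff_coeff_yExp, if_pos hu, Finsupp.single_zero, add_zero]
      exact mem_support_iff.mp (m.degree_mem_support hne)
    have hdeg : m.degree ((yExp y f).coeff 0) = m.degree f :=
      m.toSyn.injective (le_antisymm
        (m.degree_le_degree_of_support_subset (support_coeff_yExp_zero_subset y f))
        (m.le_degree hmem))
    have hJ0 : (yExp y f).coeff 0 ∈ J := by
      rw [← hJ.1]
      exact Ideal.span_mono (Set.sep_subset _ _) h0
    obtain ⟨g, hg, hle⟩ := hJ.exists_degree_le hG.zero_notMem hJ0 (by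
      intro h
      rw [h] at hmem
      simp at hmem)
    rw [hdeg] at hle
    have hg0 : g.degreeOf y = 0 := by
      have := hle y
      rw [hG.degree_apply g hg, hu] at this
      exact Nat.le_zero.mp this
    exact ⟨g, Or.inl ⟨g, ⟨hg, hg0⟩, initCoeff_of_degreeOf hg0⟩, hle⟩
  · classical
    refine ⟨X y, Or.inr rfl, ?_⟩
    rw [X, m.degree_monomial, if_neg one_ne_zero, Finsupp.single_le_iff]
    omega

end LinearInitial

/-! ### Rank functions and diagrams -/

section Rank

variable {n : ℕ} (σ : Equiv.Perm (Fin n))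

theorem rankAt_succ_row {i i' : Fin n} (h : i.val = i'.val + 1) (j : Fin n) :
    rankAt σ i j = rankAt σ i' j + if σ i ≤ j then 1 else 0 := by
  have h1 : (Finset.univ.filter fun x : Fin n => x ≤ i ∧ σ x ≤ j) =
      (Finset.univ.filter fun x : Fin n => x ≤ i' ∧ σ x ≤ j) ∪
        (Finset.univ.filter fun x : Fin n => x = i ∧ σ i ≤ j) := by
    ext x
    simp only [Finset.mem_filter, Finset.mem_univ, true_and, Finset.mem_union]
    constructor
    · rintro ⟨hx, hj⟩
      by_cases hxi : x = i
      · exact Or.inr ⟨hxi, hxi ▸ hj⟩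
      · refine Or.inl ⟨?_, hj⟩
        rw [Fin.ext_iff] at hxi
        rw [Fin.le_def] at *
        omega
    · rintro (⟨hx, hj⟩ | ⟨rfl, hj⟩)
      · refine ⟨?_, hj⟩
        rw [Fin.le_def] at *
        omega
      · exact ⟨le_rfl, hj⟩
  rw [rankAt, h1, Finset.card_union_of_disjoint]
  · rw [rankAt]
    congr 1
    split_ifs with hj <;> simp [hj, Finset.filter_eq']
  · rw [Finset.disjoint_filter]
    rintro x - ⟨hx, -⟩ ⟨rfl, -⟩
    rw [Fin.le_def] at hx
    omega

theorem rankAt_symm (i j : Fin n) : rankAt σ.symm j i = rankAt σ i j := by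
  refine Finset.card_bij (fun x _ => σ.symm x) ?_ ?_ ?_
  · intro x hx
    simpa [and_comm] using hx
  · intro x _ y _ h
    exact σ.symm.injective h
  · intro x hx
    exact ⟨σ x, by simpa [and_comm] using hx, by simp⟩

theorem rankAt_succ_column (i : Fin n) {j j' : Fin n} (h : j.val = j'.val + 1) :
    rankAt σ i j = rankAt σ i j' + if σ.symm j ≤ i then 1 else 0 := by
  rw [← rankAt_symm σ i j, ← rankAt_symm σ i j', rankAt_succ_row _ h]

theorem rankAt_mono {i i' j j' : Fin n} (hi : i ≤ i') (hj : j ≤ j') :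
    rankAt σ i j ≤ rankAt σ i' j' := by
  refine Finset.card_le_card fun x hx => ?_
  simp only [Finset.mem_filter, Finset.mem_univ, true_and] at hx ⊢
  exact ⟨hx.1.trans hi, hx.2.trans hj⟩

theorem rankAt_pos_of_le {i j x : Fin n} (hx : x ≤ i) (hj : σ x ≤ j) : 0 < rankAt σ i j :=
  Finset.card_pos.mpr ⟨x, by simp [hx, hj]⟩

theorem rankAt_mul_swap {a b : Fin n} (hab : a < b) (hσ : σ a < σ b) (i j : Fin n) :
    rankAt (σ * Equiv.swap a b) i j +
      (if a ≤ i ∧ i < b ∧ σ a ≤ j ∧ j < σ b then 1 else 0) = rankAt σ i j := by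
  have hsplit : ∀ τ : Equiv.Perm (Fin n), rankAt τ i j =
      (if a ≤ i ∧ τ a ≤ j then 1 else 0) + ((if b ≤ i ∧ τ b ≤ j then 1 else 0) +
        ∑ x ∈ (Finset.univ.erase a).erase b, if x ≤ i ∧ τ x ≤ j then 1 else 0) := by
    intro τ
    rw [rankAt, Finset.card_filter, ← Finset.add_sum_erase _ _ (Finset.mem_univ a),
      ← Finset.add_sum_erase (Finset.univ.erase a) _
        (Finset.mem_erase.mpr ⟨hab.ne', Finset.mem_univ b⟩)]
  have hrest : ∑ x ∈ (Finset.univ.erase a).erase b,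
      (if x ≤ i ∧ (σ * Equiv.swap a b) x ≤ j then 1 else 0) =
      ∑ x ∈ (Finset.univ.erase a).erase b, if x ≤ i ∧ σ x ≤ j then 1 else 0 := by
    refine Finset.sum_congr rfl fun x hx => ?_
    simp only [Finset.mem_erase, Finset.mem_univ, and_true] at hx
    rw [Equiv.Perm.mul_apply, Equiv.swap_apply_of_ne_of_ne hx.2 hx.1]
  rw [hsplit, hsplit σ, hrest, Equiv.Perm.mul_apply, Equiv.Perm.mul_apply,
    Equiv.swap_apply_left, Equiv.swap_apply_right]
  generalize ∑ x ∈ (Finset.univ.erase a).erase b, (if x ≤ i ∧ σ x ≤ j then 1 else 0) = S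
  simp only [Fin.le_def, Fin.lt_def] at *
  split_ifs <;> omega

/-- Walk south or east inside the diagram until this is impossible; a step into another box of the
diagram meets no new dot, so the rank is constant. -/
theorem exists_mem_essentialSet_of_mem_diagram {i j : Fin n} (h : (i, j) ∈ diagram σ) :
    ∃ e ∈ essentialSet σ, i ≤ e.1 ∧ j ≤ e.2 ∧ rankAt σ e.1 e.2 = rankAt σ i j := by
  generalize hN : (n - i.val) + (n - j.val) = N
  induction N using Nat.strong_induction_on generalizing i j with
  | _ N ih =>
    by_cases he : (i, j) ∈ essentialSet σ
    · exact ⟨_, he, le_rfl, le_rfl, rfl⟩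
    · rw [essentialSet, Set.mem_ofPred_eq, not_and, not_and_or] at he
      rcases he h with h1 | h1 <;> push Not at h1 <;> obtain ⟨x, hx, hxD⟩ := h1
      · have hx : x.val = i.val + 1 := hx
        obtain ⟨e, he, h1, h2, h3⟩ := ih _ (by dsimp only; omega) hxD rfl
        refine ⟨e, he, le_trans (Fin.le_def.mpr (by omega)) h1, h2, ?_⟩
        rw [h3, rankAt_succ_row σ hx, if_neg (not_le.mpr hxD.1), add_zero]
      · have hx : x.val = j.val + 1 := hx
        obtain ⟨e, he, h1, h2, h3⟩ := ih _ (by dsimp only; omega) hxD rfl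
        refine ⟨e, he, h1, le_trans (Fin.le_def.mpr (by omega)) h2, ?_⟩
        rw [h3, rankAt_succ_column σ i hx, if_neg (not_le.mpr hxD.2), add_zero]

end Rank

/-! ### Minors of the generic matrix -/

section Minors

variable {k : Type*} [Field k] {n : ℕ}

/-- The minors of size `s` in the northwest submatrix at `(i, j)`. -/
def northwestMinors (k : Type*) [Field k] {n : ℕ} (s : ℕ) (i j : Fin n) :
    Set (MvPolynomial (Fin n × Fin n) k) :=
  {f | ∃ r c : Fin s ↪o Fin n, (∀ a, r a ≤ i) ∧ (∀ a, c a ≤ j) ∧ f = genericMinor k r c}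

theorem rankMinors_eq (σ : Equiv.Perm (Fin n)) (i j : Fin n) :
    rankMinors k σ i j = northwestMinors k (1 + rankAt σ i j) i j := rfl

theorem northwestMinors_mono (s : ℕ) {i i' j j' : Fin n} (hi : i ≤ i') (hj : j ≤ j') :
    northwestMinors k s i j ⊆ northwestMinors k s i' j' := by
  rintro _ ⟨r, c, hr, hc, rfl⟩
  exact ⟨r, c, fun a => (hr a).trans hi, fun a => (hc a).trans hj, rfl⟩

theorem genericMinor_succ_row {s : ℕ} (r c : Fin (s + 1) ↪o Fin n) :
    genericMinor k r c = ∑ j : Fin (s + 1), (-1) ^ (s + j : ℕ) * X (r (Fin.last s), c j) *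
      genericMinor k (Fin.castSuccOrderEmb.trans r) ((Fin.succAboveOrderEmb j).trans c) := by
  rw [genericMinor, Matrix.det_succ_row _ (Fin.last s)]
  refine Finset.sum_congr rfl fun j _ => ?_
  rw [genericMinor, Matrix.submatrix_submatrix, Matrix.submatrix_apply,
    Matrix.mvPolynomialX_apply, Fin.val_last, Fin.succAbove_last]
  rfl

theorem genericMinor_succ_column {s : ℕ} (r c : Fin (s + 1) ↪o Fin n) :
    genericMinor k r c = ∑ i : Fin (s + 1), (-1) ^ (i + s : ℕ) * X (r i, c (Fin.last s)) *
      genericMinor k ((Fin.succAboveOrderEmb i).trans r) (Fin.castSuccOrderEmb.trans c) := by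
  rw [genericMinor, Matrix.det_succ_column _ (Fin.last s)]
  refine Finset.sum_congr rfl fun j _ => ?_
  rw [genericMinor, Matrix.submatrix_submatrix, Matrix.submatrix_apply,
    Matrix.mvPolynomialX_apply, Fin.val_last, Fin.succAbove_last]
  rfl

theorem degree_genericMinor {m : MonomialOrder (Fin n × Fin n)} (hm : IsDiagonalOrder k m)
    {s : ℕ} (r c : Fin s ↪o Fin n) :
    m.degree (genericMinor k r c) = ∑ a : Fin s, Finsupp.single (r a, c a) 1 := by
  classical
  have h : ∏ a : Fin s, (X (r a, c a) : MvPolynomial (Fin n × Fin n) k) =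
      monomial (∑ a : Fin s, Finsupp.single (r a, c a) 1) 1 := by
    rw [monomial_sum_one]; rfl
  rw [← m.degree_leadingTerm, hm, h, m.degree_monomial, if_neg one_ne_zero]

theorem genericMinor_ne_zero {m : MonomialOrder (Fin n × Fin n)} (hm : IsDiagonalOrder k m)
    {s : ℕ} (r c : Fin s ↪o Fin n) : genericMinor k r c ≠ 0 := by
  rw [Ne, ← m.leadingTerm_eq_zero_iff, hm]
  exact Finset.prod_ne_zero_iff.mpr fun a _ => X_ne_zero _

theorem degree_genericMinor_castSucc_le {m : MonomialOrder (Fin n × Fin n)}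
    (hm : IsDiagonalOrder k m) {s : ℕ} (r c : Fin (s + 1) ↪o Fin n) :
    m.degree (genericMinor k (Fin.castSuccOrderEmb.trans r) (Fin.castSuccOrderEmb.trans c)) ≤
      m.degree (genericMinor k r c) := by
  rw [degree_genericMinor hm, degree_genericMinor hm, Fin.sum_univ_castSucc]
  exact le_self_add

theorem apply_castSucc_le {s : ℕ} {r : Fin (s + 1) ↪o Fin n} {i i' : Fin n}
    (hi : i.val ≤ i'.val + 1) (hr : ∀ a, r a ≤ i) (a : Fin s) : r a.castSucc ≤ i' := by
  have h1 : r a.castSucc < r (Fin.last s) := r.strictMono (Fin.castSucc_lt_last a)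
  have h2 := hr (Fin.last s)
  rw [Fin.le_def] at *
  rw [Fin.lt_def] at h1
  omega

theorem mem_span_northwestMinors_row {s : ℕ} {i i' j : Fin n} (hi : i.val ≤ i'.val + 1)
    {f : MvPolynomial (Fin n × Fin n) k} (hf : f ∈ northwestMinors k (s + 1) i j) :
    f ∈ Ideal.span (northwestMinors k s i' j) := by
  obtain ⟨r, c, hr, hc, rfl⟩ := hf
  rw [genericMinor_succ_row]
  exact Ideal.sum_mem _ fun a _ => Ideal.mul_mem_left _ _ <| Ideal.subset_span
    ⟨_, _, apply_castSucc_le hi hr, fun b => hc _, rfl⟩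

theorem mem_span_northwestMinors_column {s : ℕ} {i j j' : Fin n} (hj : j.val ≤ j'.val + 1)
    {f : MvPolynomial (Fin n × Fin n) k} (hf : f ∈ northwestMinors k (s + 1) i j) :
    f ∈ Ideal.span (northwestMinors k s i j') := by
  obtain ⟨r, c, hr, hc, rfl⟩ := hf
  rw [genericMinor_succ_column]
  exact Ideal.sum_mem _ fun a _ => Ideal.mul_mem_left _ _ <| Ideal.subset_span
    ⟨_, _, fun b => hr _, apply_castSucc_le hj hc, rfl⟩

theorem exists_degree_le_row {m : MonomialOrder (Fin n × Fin n)} (hm : IsDiagonalOrder k m)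
    {s : ℕ} {i i' j : Fin n} (hi : i.val ≤ i'.val + 1)
    {f : MvPolynomial (Fin n × Fin n) k} (hf : f ∈ northwestMinors k (s + 1) i j) :
    ∃ g ∈ northwestMinors k s i' j, m.degree g ≤ m.degree f := by
  obtain ⟨r, c, hr, hc, rfl⟩ := hf
  exact ⟨_, ⟨_, _, apply_castSucc_le hi hr, fun b => hc _, rfl⟩,
    degree_genericMinor_castSucc_le hm r c⟩

theorem exists_degree_le_column {m : MonomialOrder (Fin n × Fin n)} (hm : IsDiagonalOrder k m)
    {s : ℕ} {i j j' : Fin n} (hj : j.val ≤ j'.val + 1)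
    {f : MvPolynomial (Fin n × Fin n) k} (hf : f ∈ northwestMinors k (s + 1) i j) :
    ∃ g ∈ northwestMinors k s i j', m.degree g ≤ m.degree f := by
  obtain ⟨r, c, hr, hc, rfl⟩ := hf
  exact ⟨_, ⟨_, _, fun b => hr _, apply_castSucc_le hj hc, rfl⟩,
    degree_genericMinor_castSucc_le hm r c⟩

theorem mem_span_northwestMinors_of_le {s s' : ℕ} (h : s ≤ s') {i j : Fin n}
    {f : MvPolynomial (Fin n × Fin n) k} (hf : f ∈ northwestMinors k s' i j) :
    f ∈ Ideal.span (northwestMinors k s i j) := by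
  induction s', h using Nat.le_induction generalizing f with
  | base => exact Ideal.subset_span hf
  | succ s' _ ih =>
    exact Ideal.span_le.mpr (fun g hg => ih hg) (mem_span_northwestMinors_row (Nat.le_succ _) hf)

theorem exists_degree_le_of_le {m : MonomialOrder (Fin n × Fin n)} (hm : IsDiagonalOrder k m)
    {s s' : ℕ} (h : s ≤ s') {i j : Fin n}
    {f : MvPolynomial (Fin n × Fin n) k} (hf : f ∈ northwestMinors k s' i j) :
    ∃ g ∈ northwestMinors k s i j, m.degree g ≤ m.degree f := by
  induction s', h using Nat.le_induction generalizing f with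
  | base => exact ⟨f, hf, le_rfl⟩
  | succ s' _ ih =>
    obtain ⟨g, hg, hle⟩ := exists_degree_le_row hm (Nat.le_succ _) hf
    obtain ⟨g', hg', hle'⟩ := ih hg
    exact ⟨g', hg', hle'.trans hle⟩

theorem northwestMinors_eq_empty {s : ℕ} (hs : 2 ≤ s) {i j : Fin n}
    (h : i.val = 0 ∨ j.val = 0) : northwestMinors k s i j = ∅ := by
  rw [Set.eq_empty_iff_forall_notMem]
  rintro _ ⟨r, c, hr, hc, rfl⟩
  have h01 : (⟨0, by omega⟩ : Fin s) < ⟨1, by omega⟩ := Fin.mk_lt_mk.mpr one_pos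
  have h1 := r.strictMono h01
  have h2 := c.strictMono h01
  have h3 := hr ⟨1, by omega⟩
  have h4 := hc ⟨1, by omega⟩
  rw [Fin.lt_def] at h1 h2
  rw [Fin.le_def] at h3 h4
  omega

theorem rankMinors_subset_essentialMinors {σ : Equiv.Perm (Fin n)} {i j : Fin n}
    (h : (i, j) ∈ diagram σ) : rankMinors k σ i j ⊆ essentialMinors k σ := by
  intro f hf
  obtain ⟨e, he, hi, hj, hr⟩ := exists_mem_essentialSet_of_mem_diagram σ h
  refine Set.mem_biUnion he ?_
  rw [rankMinors_eq, hr]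
  exact northwestMinors_mono _ hi hj hf

/-- Fulton: minors at the boxes of the essential set generate the Schubert determinantal ideal,
and their diagonal terms divide those of all other defining minors. -/
theorem rankMinors_essential {m : MonomialOrder (Fin n × Fin n)} (hm : IsDiagonalOrder k m)
    (σ : Equiv.Perm (Fin n)) (i j : Fin n) {f : MvPolynomial (Fin n × Fin n) k}
    (hf : f ∈ rankMinors k σ i j) :
    f ∈ Ideal.span (essentialMinors k σ) ∧ ∃ g ∈ essentialMinors k σ, m.degree g ≤ m.degree f := by
  generalize hN : i.val + j.val = N
  induction N using Nat.strong_induction_on generalizing i j f with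
  | _ N ih =>
    have step : ∀ (i' j' : Fin n), i'.val + j'.val < N →
        f ∈ Ideal.span (rankMinors k σ i' j') →
        (∃ g ∈ rankMinors k σ i' j', m.degree g ≤ m.degree f) →
        f ∈ Ideal.span (essentialMinors k σ) ∧
          ∃ g ∈ essentialMinors k σ, m.degree g ≤ m.degree f := by
      rintro i' j' hlt h1 ⟨g, hg, hle⟩
      refine ⟨Ideal.span_le.mpr (fun g hg => (ih _ hlt i' j' hg rfl).1) h1, ?_⟩
      obtain ⟨g', hg', hle'⟩ := (ih _ hlt i' j' hg rfl).2
      exact ⟨g', hg', hle'.trans hle⟩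
    rw [rankMinors_eq] at hf
    -- The dot of row `i` raises the rank by one, so expansion along the last row reduces to the box
    -- above. In the top row the minors have size at least `2` and there are none.
    by_cases h1 : σ i ≤ j
    · have hpos := rankAt_pos_of_le σ (le_refl i) h1
      by_cases hi : i.val = 0
      · rw [northwestMinors_eq_empty (by omega) (Or.inl hi)] at hf
        exact absurd hf (Set.notMem_empty f)
      · let i' : Fin n := ⟨i.val - 1, by omega⟩
        have hi' : i.val = i'.val + 1 := by simp only [i']; omega
        rw [rankAt_succ_row σ hi', if_pos h1, ← add_assoc] at hf
        exact step i' j (by omega) (mem_span_northwestMinors_row hi'.le hf)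
          (exists_degree_le_row hm hi'.le hf)
    · by_cases h2 : σ.symm j ≤ i
      · have hpos := rankAt_pos_of_le σ h2 (by simp : σ (σ.symm j) ≤ j)
        by_cases hj : j.val = 0
        · rw [northwestMinors_eq_empty (by omega) (Or.inr hj)] at hf
          exact absurd hf (Set.notMem_empty f)
        · let j' : Fin n := ⟨j.val - 1, by omega⟩
          have hj' : j.val = j'.val + 1 := by simp only [j']; omega
          rw [rankAt_succ_column σ i hj', if_pos h2, ← add_assoc] at hf
          exact step i j' (by omega) (mem_span_northwestMinors_column hj'.le hf)
            (exists_degree_le_column hm hj'.le hf)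
      · have hmem : f ∈ essentialMinors k σ :=
          rankMinors_subset_essentialMinors (i := i) (j := j) ⟨not_le.mp h1, not_le.mp h2⟩ hf
        exact ⟨Ideal.subset_span hmem, f, hmem, le_rfl⟩

theorem span_essentialMinors {m : MonomialOrder (Fin n × Fin n)} (hm : IsDiagonalOrder k m)
    (σ : Equiv.Perm (Fin n)) : Ideal.span (essentialMinors k σ) = schubertIdeal k σ := by
  apply le_antisymm
  · refine Ideal.span_mono (Set.iUnion₂_subset fun b _ => ?_)
    exact Set.subset_iUnion₂ (s := fun p q => rankMinors k σ p q) b.1 b.2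
  · rw [schubertIdeal, Ideal.span_le]
    refine Set.iUnion₂_subset fun i j f hf => (rankMinors_essential hm σ i j hf).1

theorem northwestMinors_subset_schubertIdeal {σ : Equiv.Perm (Fin n)} {s : ℕ} {i j : Fin n}
    (h : 1 + rankAt σ i j ≤ s) {f : MvPolynomial (Fin n × Fin n) k}
    (hf : f ∈ northwestMinors k s i j) : f ∈ schubertIdeal k σ :=
  Ideal.span_mono (Set.subset_iUnion₂ (s := fun p q => rankMinors k σ p q) i j)
    (mem_span_northwestMinors_of_le h hf)

theorem exists_essentialMinor_degree_le {m : MonomialOrder (Fin n × Fin n)}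
    (hm : IsDiagonalOrder k m) {σ : Equiv.Perm (Fin n)} {s : ℕ} {i j : Fin n}
    (h : 1 + rankAt σ i j ≤ s) {f : MvPolynomial (Fin n × Fin n) k}
    (hf : f ∈ northwestMinors k s i j) :
    ∃ g ∈ essentialMinors k σ, m.degree g ≤ m.degree f := by
  obtain ⟨g, hg, hle⟩ := exists_degree_le_of_le hm h hf
  obtain ⟨g', hg', hle'⟩ := (rankMinors_essential hm σ i j hg).2
  exact ⟨g', hg', hle'.trans hle⟩

/-! ### Dependence of a minor on one variable -/

theorem degreeOf_genericMinor_eq_zero {s : ℕ} {r c : Fin s ↪o Fin n} {p q : Fin n}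
    (h : (∀ a, r a ≠ p) ∨ ∀ a, c a ≠ q) : (genericMinor k r c).degreeOf (p, q) = 0 := by
  apply degreeOf_eq_zero_of_yExp (g := genericMinor k r c)
  rw [genericMinor, AlgHom.map_det, RingHom.map_det]
  congr 1
  ext1 a b
  refine yExp_X_of_ne fun hab => ?_
  rw [Prod.mk.injEq] at hab
  rcases h with h | h
  · exact h a hab.1
  · exact h b hab.2

theorem yExp_genericMinor {s : ℕ} {r c : Fin (s + 1) ↪o Fin n} {p q : Fin n}
    (hr : r (Fin.last s) = p) (hc : c (Fin.last s) = q) :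
    ∃ h : MvPolynomial (Fin n × Fin n) k, yExp (p, q) (genericMinor k r c) =
      Polynomial.C (genericMinor k (Fin.castSuccOrderEmb.trans r)
        (Fin.castSuccOrderEmb.trans c)) * Polynomial.X + Polynomial.C h := by
  have hfree : ∀ c' : Fin s ↪o Fin n, yExp (p, q)
      (genericMinor k (Fin.castSuccOrderEmb.trans r) c') =
        Polynomial.C (genericMinor k (Fin.castSuccOrderEmb.trans r) c') := fun c' =>
    yExp_of_degreeOf_eq_zero <| degreeOf_genericMinor_eq_zero <| Or.inl fun a h =>
      (Fin.castSucc_lt_last a).ne (r.injective (h.trans hr.symm))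
  refine ⟨∑ j : Fin s, (-1) ^ (s + j : ℕ) * X (p, c j.castSucc) *
      genericMinor k (Fin.castSuccOrderEmb.trans r)
        ((Fin.succAboveOrderEmb j.castSucc).trans c), ?_⟩
  rw [genericMinor_succ_row, Fin.sum_univ_castSucc, map_add, map_sum, map_sum, add_comm]
  congr 1
  · have : Fin.succAboveOrderEmb (Fin.last s) = Fin.castSuccOrderEmb := by
      ext a; simp
    rw [this, Fin.val_last, ← two_mul, pow_mul, neg_one_sq, one_pow, one_mul, map_mul, hfree, hr,
      hc, yExp_X_self, mul_comm]
  · refine Finset.sum_congr rfl fun j _ => ?_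
    have hne : (p, c j.castSucc) ≠ (p, q) := by
      intro h
      exact (Fin.castSucc_lt_last j).ne (c.injective ((Prod.mk.inj h).2.trans hc.symm))
    rw [map_mul, map_mul, hfree, hr, yExp_X_of_ne hne, map_mul, map_mul, map_pow, map_neg,
      map_one, map_pow, map_neg, map_one, Fin.val_castSucc]

theorem degreeOf_genericMinor_eq_one {m : MonomialOrder (Fin n × Fin n)}
    (hm : IsDiagonalOrder k m) {s : ℕ} {r c : Fin (s + 1) ↪o Fin n} {p q : Fin n}
    (hr : r (Fin.last s) = p) (hc : c (Fin.last s) = q) :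
    (genericMinor k r c).degreeOf (p, q) = 1 := by
  obtain ⟨h, hh⟩ := yExp_genericMinor (k := k) hr hc
  rw [← natDegree_yExp, hh]
  exact Polynomial.natDegree_linear (genericMinor_ne_zero hm _ _)

theorem initCoeff_genericMinor {m : MonomialOrder (Fin n × Fin n)}
    (hm : IsDiagonalOrder k m) {s : ℕ} {r c : Fin (s + 1) ↪o Fin n} {p q : Fin n}
    (hr : r (Fin.last s) = p) (hc : c (Fin.last s) = q) :
    initCoeff (p, q) (genericMinor k r c) =
      genericMinor k (Fin.castSuccOrderEmb.trans r) (Fin.castSuccOrderEmb.trans c) := by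
  obtain ⟨h, hh⟩ := yExp_genericMinor (k := k) hr hc
  rw [initCoeff_eq, degreeOf_genericMinor_eq_one hm hr hc, hh]
  simp

end Minors

/-! ### Accessible boxes -/

section Accessible

variable {n : ℕ} {π : Equiv.Perm (Fin n)} {p q : Fin n}

theorem permP_apply_left : permP π p q p = q := by
  simp [permP]

theorem permP_apply_right : permP π p q (π.symm q) = π p := by
  simp [permP]

theorem permP_apply_of_ne {i : Fin n} (h : i ≠ p) (h' : π i ≠ q) : permP π p q i = π i := by
  have : i ≠ π.symm q := fun e => h' (by simp [e])
  rw [permP, Equiv.Perm.mul_apply, Equiv.swap_apply_of_ne_of_ne h this]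

theorem permP_mul_swap : permP π p q * Equiv.swap p (π.symm q) = π := by
  rw [permP, mul_assoc, Equiv.swap_mul_self, mul_one]

theorem IsAccessible.not_le_of_mem (h : IsAccessible π p q) {i j : Fin n}
    (hD : (i, j) ∈ diagram π) (hne : (i, j) ≠ (p, q)) : ¬ (p ≤ i ∧ q ≤ j) :=
  fun hle => hne (h.2.2 i j hD hle.1 hle.2)

/-- `π` arises from `permP` by exchanging two dots in northwest–southeast position, the upper one at
`(p, q)`, so ranks change only southeast of `(p, q)`. -/
theorem IsAccessible.rankAt_permP (h : IsAccessible π p q) {i j : Fin n}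
    (hij : ¬ (p ≤ i ∧ q ≤ j)) : rankAt (permP π p q) i j = rankAt π i j := by
  have h1 := rankAt_mul_swap (permP π p q) h.1.2
    (by rw [permP_apply_left, permP_apply_right]; exact h.1.1) i j
  rw [permP_mul_swap, permP_apply_left, if_neg (fun h' => hij ⟨h'.1, h'.2.2.1⟩)] at h1
  exact h1.symm

/-- A box gained by the diagram would lie in row `π⁻¹ q` east of column `q`, or in column `π p`
south of row `p`. It would force a box `(p, j)` with `j > q`, or `(i, q)` with `i > p`, into the
diagram of `π`, against accessibility. -/
theorem IsAccessible.diagram_permP (h : IsAccessible π p q) {i j : Fin n}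
    (hD : (i, j) ∈ diagram (permP π p q)) : (i, j) ∈ diagram π ∧ ¬ (p ≤ i ∧ q ≤ j) := by
  have hDp : q < π p ∧ p < π.symm q := h.1
  have hacc : ∀ x y : Fin n, y < π x → x < π.symm y → p ≤ x → q ≤ y → x = p ∧ y = q :=
    fun x y h1 h2 h3 h4 => Prod.mk.inj (h.2.2 x y ⟨h1, h2⟩ h3 h4)
  have h1 : j < permP π p q i := hD.1
  have h2 : i < (permP π p q).symm j := hD.2
  have hp : (permP π p q).symm q = p := by rw [Equiv.symm_apply_eq, permP_apply_left]
  have hs : (permP π p q).symm (π p) = π.symm q := by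
    rw [Equiv.symm_apply_eq, permP_apply_right]
  have hsymm : ∀ y, y ≠ q → y ≠ π p → (permP π p q).symm y = π.symm y := by
    intro y hq hy
    rw [Equiv.symm_apply_eq, permP_apply_of_ne]
    · simp
    · intro e
      exact hy (by rw [← e]; simp)
    · simpa using hq
  have hne : (i, j) ≠ (p, q) := by
    intro e
    rw [Prod.mk.injEq] at e
    rw [e.1, e.2, permP_apply_left] at h1
    exact lt_irrefl _ h1
  suffices hmem : (i, j) ∈ diagram π from ⟨hmem, h.not_le_of_mem hmem hne⟩
  have hrow : j < π i := by
    by_cases hip : i = p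
    · rw [hip, permP_apply_left] at h1
      rw [hip]
      exact h1.trans hDp.1
    by_cases hiq : π i = q
    · have his : i = π.symm q := by simp [← hiq]
      rw [his, permP_apply_right] at h1
      rcases lt_trichotomy j q with hj | hj | hj
      · rwa [hiq]
      · rw [hj, hp, his] at h2
        exact absurd (h2.trans hDp.2) (lt_irrefl _)
      · rw [hsymm j hj.ne' h1.ne, his] at h2
        exact absurd (hacc p j h1 (hDp.2.trans h2) le_rfl hj.le).2 hj.ne'
    · rwa [permP_apply_of_ne hip hiq] at h1
  refine ⟨hrow, ?_⟩
  change i < π.symm j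
  by_cases hjq : j = q
  · rw [hjq, hp] at h2
    rw [hjq]
    exact h2.trans hDp.2
  by_cases hjp : j = π p
  · rw [hjp, hs] at h2
    rw [hjp, Equiv.symm_apply_apply]
    rcases lt_trichotomy i p with hi | hi | hi
    · exact hi
    · rw [hi, permP_apply_left, hjp] at h1
      exact absurd (h1.trans hDp.1) (lt_irrefl _)
    · exact absurd (hacc i q ((hDp.1.trans_eq hjp.symm).trans hrow) h2 hi.le le_rfl).1 hi.ne'
  · rwa [hsymm j hjq hjp] at h2

/-- The dot `(t, π t)` is weakly southeast of all dots strictly northwest of `(p, q)`, and is one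
of them. -/
structure IsLastDot (π : Equiv.Perm (Fin n)) (p q t : Fin n) : Prop where
  row_lt : t < p
  column_lt : π t < q
  le : ∀ x, x < p → π x < q → x ≤ t ∧ π x ≤ π t

theorem IsAccessible.lt_of_le (h : IsAccessible π p q) {x : Fin n} (hx : x ≤ p) (hπ : π x ≤ q) :
    x < p ∧ π x < q := by
  have hDp : q < π p ∧ p < π.symm q := h.1
  constructor
  · refine lt_of_le_of_ne hx ?_
    rintro rfl
    exact absurd (hπ.trans_lt hDp.1) (lt_irrefl _)
  · refine lt_of_le_of_ne hπ ?_
    intro e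
    rw [← e, Equiv.symm_apply_apply] at hDp
    exact absurd (hx.trans_lt hDp.2) (lt_irrefl _)

theorem IsAccessible.exists_isLastDot (h : IsAccessible π p q) (hπ : IsVexillary π) :
    ∃ t, IsLastDot π p q t := by
  have hDp : q < π p ∧ p < π.symm q := h.1
  obtain ⟨x, hx⟩ := Finset.card_pos.mp (Nat.pos_of_ne_zero h.2.1)
  have hne : (Finset.univ.filter fun x : Fin n => x < p ∧ π x < q).Nonempty := by
    simp only [Finset.mem_filter, Finset.mem_univ, true_and] at hx
    exact ⟨x, by simpa using h.lt_of_le hx.1 hx.2⟩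
  obtain ⟨t, ht, hmax⟩ := Finset.exists_max_image _ id hne
  simp only [Finset.mem_filter, Finset.mem_univ, true_and, id] at ht hmax
  refine ⟨t, ht.1, ht.2, fun x hx hxq => ⟨hmax x ⟨hx, hxq⟩, ?_⟩⟩
  by_contra! hlt
  have hxt : x < t := lt_of_le_of_ne (hmax x ⟨hx, hxq⟩) (by rintro rfl; exact lt_irrefl _ hlt)
  -- The lowest dot `t` is also the rightmost: otherwise rows `x < t < p < π⁻¹ q` carry the values
  -- `π x`, `π t`, `π p`, `q`, a 2143 pattern.
  refine hπ ⟨x, t, p, π.symm q, hxt, ht.1, hDp.2, hlt, ?_, ?_⟩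
  · simpa using hxq
  · simpa using hDp.1

theorem IsLastDot.isCornerDot {t : Fin n} (ht : IsLastDot π p q t) (h : IsAccessible π p q) :
    IsCornerDot π p q t := by
  -- A box of this rectangle could be missing only because of a dot west or north of it. That dot
  -- would be northwest of `(p, q)`, yet below or to the right of the last one.
  have hrect : ∀ i j : Fin n, t < i → i ≤ p → π t < j → j ≤ q → (i, j) ∈ diagram π := by
    intro i j h1 h2 h3 h4
    constructor
    · by_contra! hle
      have hle : π i ≤ j := hle
      obtain ⟨h5, h6⟩ := h.lt_of_le h2 (hle.trans h4)
      exact absurd (ht.le i h5 h6).1 (not_le.mpr h1)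
    · by_contra! hle
      have hle : π.symm j ≤ i := hle
      obtain ⟨h5, h6⟩ := h.lt_of_le (hle.trans h2) (by simpa using h4)
      have := (ht.le _ h5 h6).2
      rw [Equiv.apply_symm_apply] at this
      exact absurd this (not_le.mpr h3)
  have hconn : ∀ d : ℕ, ∀ i j : Fin n, t < i → i ≤ p → π t < j → j ≤ q →
      (p.val - i.val) + (q.val - j.val) = d → (i, j) ∈ diagramComponent π (p, q) := by
    intro d
    induction d with
    | zero =>
      intro i j h1 h2 h3 h4 hd
      rw [Fin.le_def] at h2 h4
      have hi : i = p := Fin.ext (by omega)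
      have hj : j = q := Fin.ext (by omega)
      rw [hi, hj]
      exact Relation.ReflTransGen.refl
    | succ d ih =>
      intro i j h1 h2 h3 h4 hd
      by_cases hi : i = p
      · have hj : j.val < q.val := by
          have : i.val = p.val := by rw [hi]
          omega
        let j' : Fin n := ⟨j.val + 1, by omega⟩
        have hjj : j < j' := Fin.lt_def.mpr (Nat.lt_succ_self _)
        have hj' : j' ≤ q := Fin.le_def.mpr hj
        refine (ih i j' h1 h2 (h3.trans hjj) hj' ?_).tail
          ⟨hrect _ _ h1 h2 (h3.trans hjj) hj', hrect _ _ h1 h2 h3 h4, Or.inl ⟨rfl, Or.inr rfl⟩⟩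
        simp only [j']; omega
      · have hi : i.val < p.val := Fin.lt_def.mp (lt_of_le_of_ne h2 hi)
        let i' : Fin n := ⟨i.val + 1, by omega⟩
        have hii : i < i' := Fin.lt_def.mpr (Nat.lt_succ_self _)
        have hi' : i' ≤ p := Fin.le_def.mpr hi
        refine (ih i' j (h1.trans hii) hi' h3 h4 ?_).tail
          ⟨hrect _ _ (h1.trans hii) hi' h3 h4, hrect _ _ h1 h2 h3 h4, Or.inr ⟨rfl, Or.inr rfl⟩⟩
        simp only [i']; omega
  -- A path leaving this quadrant would have to enter row `t` east of the dot or column `π t` south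
  -- of it, where the diagram has no box.
  have hbound : ∀ c ∈ diagramComponent π (p, q), t < c.1 ∧ π t < c.2 := by
    intro c hc
    induction hc with
    | refl => exact ⟨ht.row_lt, ht.column_lt⟩
    | @tail b c _ hbc ih =>
      obtain ⟨hb, ⟨hc1, hc2⟩, hadj⟩ := hbc
      have hrow : t < c.1 → c.2 ≠ π t := by
        rintro hlt e
        rw [e, Equiv.symm_apply_apply] at hc2
        exact lt_asymm hlt hc2
      have hcol : π t < c.2 → c.1 ≠ t := by
        rintro hlt e
        rw [e] at hc1
        exact lt_asymm hlt hc1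
      simp only [Fin.lt_def, Ne, Fin.ext_iff] at ih hrow hcol ⊢
      rcases hadj with ⟨e, h' | h'⟩ | ⟨e, h' | h'⟩ <;> rw [Fin.ext_iff] at e <;> omega
  have htp := Fin.lt_def.mp ht.row_lt
  have htq := Fin.lt_def.mp ht.column_lt
  refine ⟨⟨t.val + 1, by omega⟩, ⟨(π t).val + 1, by omega⟩, ?_, ?_, rfl, rfl⟩
  · exact hconn _ _ _ (Fin.lt_def.mpr (Nat.lt_succ_self _)) (Fin.le_def.mpr htp)
      (Fin.lt_def.mpr (Nat.lt_succ_self _)) (Fin.le_def.mpr htq) rfl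
  · intro c hc
    obtain ⟨h1, h2⟩ := hbound c hc
    exact ⟨Fin.le_def.mpr (Fin.lt_def.mp h1), Fin.le_def.mpr (Fin.lt_def.mp h2)⟩

/-! ### Ranks of `π_C`. -/

theorem IsLastDot.rankAt_permC {t : Fin n} (ht : IsLastDot π p q t) (i j : Fin n) :
    rankAt (permC π p q t) i j + (if t ≤ i ∧ i < p ∧ π t ≤ j ∧ j < q then 1 else 0) =
      rankAt (permP π p q) i j := by
  have h1 : permP π p q t = π t := permP_apply_of_ne ht.row_lt.ne ht.column_lt.ne
  have h2 := rankAt_mul_swap (permP π p q) ht.row_lt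
    (by rw [h1, permP_apply_left]; exact ht.column_lt) i j
  rwa [h1, permP_apply_left] at h2

theorem IsLastDot.rankAt_permC_le {t : Fin n} (ht : IsLastDot π p q t) (i j : Fin n) :
    rankAt (permC π p q t) i j ≤ rankAt (permP π p q) i j := by
  rw [← ht.rankAt_permC i j]
  exact Nat.le_add_right _ _

/-- All dots northwest of `(p, q)` are already northwest of `(t, π t)`, so `π` has the same rank at
`(i, j)` as at `(p, q)`. -/
theorem IsLastDot.one_add_rankAt_permC {t : Fin n} (ht : IsLastDot π p q t)
    (h : IsAccessible π p q) {i j : Fin n} (hi : t ≤ i) (hip : i < p) (hj : π t ≤ j)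
    (hjq : j < q) : 1 + rankAt (permC π p q t) i j = rankAt π p q := by
  have h1 := ht.rankAt_permC i j
  rw [if_pos ⟨hi, hip, hj, hjq⟩, h.rankAt_permP (fun h' => not_le.mpr hip h'.1)] at h1
  rw [add_comm, h1]
  refine le_antisymm (rankAt_mono π hip.le hjq.le) (Finset.card_le_card fun x hx => ?_)
  simp only [Finset.mem_filter, Finset.mem_univ, true_and] at hx ⊢
  obtain ⟨h2, h3⟩ := h.lt_of_le hx.1 hx.2
  obtain ⟨h4, h5⟩ := ht.le x h2 h3
  exact ⟨h4.trans hi, h5.trans hj⟩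

/-! ### Essential minors at an accessible box -/

variable {k : Type*} [Field k] {m : MonomialOrder (Fin n × Fin n)}

theorem exists_orderEmbedding_snoc {s : ℕ} (r : Fin s ↪o Fin n) (h : ∀ a, r a < p) :
    ∃ r' : Fin (s + 1) ↪o Fin n, Fin.castSuccOrderEmb.trans r' = r ∧ r' (Fin.last s) = p := by
  have hmono : StrictMono (Fin.snoc (α := fun _ => Fin n) r p) := by
    intro a b hab
    induction b using Fin.lastCases with
    | last =>
      obtain ⟨a, rfl⟩ := Fin.exists_castSucc_eq.mpr hab.ne
      simpa using h a
    | cast b =>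
      obtain ⟨a, rfl⟩ := Fin.exists_castSucc_eq.mpr (hab.trans (Fin.castSucc_lt_last b)).ne
      simpa using hab
  refine ⟨OrderEmbedding.ofStrictMono _ hmono, ?_, ?_⟩
  · ext a; simp
  · simp

theorem degreeOf_eq_zero_of_mem_northwestMinors {s : ℕ} {i j : Fin n} (hij : ¬ (p ≤ i ∧ q ≤ j))
    {f : MvPolynomial (Fin n × Fin n) k} (hf : f ∈ northwestMinors k s i j) :
    f.degreeOf (p, q) = 0 := by
  obtain ⟨r, c, hr, hc, rfl⟩ := hf
  apply degreeOf_genericMinor_eq_zero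
  rw [not_and_or, not_le, not_le] at hij
  exact hij.imp (fun h a => ((hr a).trans_lt h).ne) (fun h a => ((hc a).trans_lt h).ne)

theorem IsAccessible.mem_essentialMinors (h : IsAccessible π p q)
    {f : MvPolynomial (Fin n × Fin n) k} (hf : f ∈ essentialMinors k π) :
    (∃ r c : Fin (rankAt π p q + 1) ↪o Fin n, r (Fin.last _) = p ∧ c (Fin.last _) = q ∧
      f = genericMinor k r c) ∨
    ∃ (s : ℕ) (i j : Fin n), ¬ (p ≤ i ∧ q ≤ j) ∧ 1 + rankAt π i j ≤ s ∧
      f ∈ northwestMinors k s i j := by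
  obtain ⟨⟨i, j⟩, he, hf⟩ := Set.mem_iUnion₂.mp hf
  by_cases hij : (i, j) = (p, q)
  · obtain ⟨rfl, rfl⟩ := Prod.mk.inj hij
    rw [rankMinors_eq, add_comm] at hf
    obtain ⟨r, c, hr, hc, rfl⟩ := hf
    by_cases hlast : r (Fin.last _) = i ∧ c (Fin.last _) = j
    · exact Or.inl ⟨r, c, hlast.1, hlast.2, rfl⟩
    -- A minor at `(p, q)` that misses row `p` or column `q` is assigned to the box of its own last
    -- row and column, whose rank is no larger.
    · refine Or.inr ⟨_, r (Fin.last _), c (Fin.last _), fun h' => hlast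
        ⟨le_antisymm (hr _) h'.1, le_antisymm (hc _) h'.2⟩, ?_, r, c,
        fun a => r.monotone (Fin.le_last a), fun a => c.monotone (Fin.le_last a), rfl⟩
      rw [add_comm]
      exact Nat.succ_le_succ (rankAt_mono π (hr _) (hc _))
  · exact Or.inr ⟨_, i, j, h.not_le_of_mem he.1 hij, le_rfl, hf⟩

theorem IsAccessible.linearInitial (h : IsAccessible π p q) (hm : IsDiagonalOrder k m) :
    LinearInitial m (p, q) (essentialMinors k π) := by
  have hne : ∀ f ∈ essentialMinors k π, f ≠ 0 := by
    intro f hf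
    obtain ⟨e, -, r, c, -, -, rfl⟩ := Set.mem_iUnion₂.mp hf
    exact genericMinor_ne_zero hm r c
  refine ⟨fun h0 => hne 0 h0 rfl, fun f hf => ?_, fun f hf => ?_⟩
  · rcases h.mem_essentialMinors hf with ⟨r, c, hr, hc, rfl⟩ | ⟨s, i, j, hij, -, hmem⟩
    · exact (degreeOf_genericMinor_eq_one hm hr hc).le
    · rw [degreeOf_eq_zero_of_mem_northwestMinors hij hmem]
      exact zero_le_one
  · rcases h.mem_essentialMinors hf with ⟨r, c, hr, hc, rfl⟩ | ⟨s, i, j, hij, -, hmem⟩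
    · rw [degreeOf_genericMinor_eq_one hm hr hc, degree_genericMinor hm, Fin.sum_univ_castSucc,
        hr, hc, Finsupp.add_apply, Finsupp.single_eq_same, Finsupp.finsetSum_apply,
        Finset.sum_eq_zero, zero_add]
      intro a _
      refine Finsupp.single_eq_of_ne fun e => ?_
      exact (Fin.castSucc_lt_last a).ne (r.injective ((Prod.mk.inj e).1.symm.trans hr.symm))
    · have h0 := degreeOf_eq_zero_of_mem_northwestMinors hij hmem
      rw [h0]
      exact Nat.le_zero.mp (degreeOf_le_iff.mp h0.le _ (m.degree_mem_support (hne f hf)))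

/-- The `y`-free essential minors belong to rank conditions not southeast of `(p, q)`, where `π` and
`π_P` have equal ranks; conversely, the diagram of `π_P` lies in that of `π`, away from this
quadrant. -/
theorem IsAccessible.span_sep_essentialMinors (h : IsAccessible π p q)
    (hm : IsDiagonalOrder k m) :
    Ideal.span {g ∈ essentialMinors k π | g.degreeOf (p, q) = 0} =
      schubertIdeal k (permP π p q) := by
  apply le_antisymm
  · rw [Ideal.span_le]
    rintro g ⟨hg, hg0⟩
    rcases h.mem_essentialMinors hg with ⟨r, c, hr, hc, rfl⟩ | ⟨s, i, j, hij, hs, hmem⟩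
    · rw [degreeOf_genericMinor_eq_one hm hr hc] at hg0
      exact absurd hg0 one_ne_zero
    · rw [← h.rankAt_permP hij] at hs
      exact northwestMinors_subset_schubertIdeal hs hmem
  · rw [← span_essentialMinors hm, Ideal.span_le]
    refine Set.iUnion₂_subset fun e he f hf => Ideal.subset_span ?_
    obtain ⟨hD, hij⟩ := h.diagram_permP (i := e.1) (j := e.2) he.1
    rw [rankMinors_eq, h.rankAt_permP hij] at hf
    exact ⟨rankMinors_subset_essentialMinors hD hf,
      degreeOf_eq_zero_of_mem_northwestMinors hij hf⟩

theorem IsLastDot.exists_of_mem_coneGens {t : Fin n} (ht : IsLastDot π p q t)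
    (h : IsAccessible π p q) (hm : IsDiagonalOrder k m) {f : MvPolynomial (Fin n × Fin n) k}
    (hf : f ∈ coneGens (p, q) (essentialMinors k π)) :
    ∃ (s : ℕ) (i j : Fin n), 1 + rankAt (permC π p q t) i j ≤ s ∧
      f ∈ northwestMinors k s i j := by
  obtain ⟨g, hg, rfl⟩ := hf
  rcases h.mem_essentialMinors hg with ⟨r, c, hr, hc, rfl⟩ | ⟨s, i, j, hij, hs, hmem⟩
  · have htp := Fin.lt_def.mp ht.row_lt
    have htq := Fin.lt_def.mp ht.column_lt
    have hpred : ∀ {x : Fin n} (hx : 0 < x.val), x.val = (⟨x.val - 1, by omega⟩ : Fin n).val + 1 :=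
      fun {x} hx => (Nat.succ_pred_eq_of_pos hx).symm
    refine ⟨rankAt π p q, ⟨p.val - 1, by omega⟩, ⟨q.val - 1, by omega⟩, ?_, ?_⟩
    · refine (ht.one_add_rankAt_permC h ?_ ?_ ?_ ?_).le
      · exact Fin.le_def.mpr (Nat.le_pred_of_lt htp)
      · exact Fin.lt_def.mpr (Nat.pred_lt_of_lt htp)
      · exact Fin.le_def.mpr (Nat.le_pred_of_lt htq)
      · exact Fin.lt_def.mpr (Nat.pred_lt_of_lt htq)
    · rw [initCoeff_genericMinor hm hr hc]
      exact ⟨_, _, apply_castSucc_le (i := p) (hpred (by omega)).le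
          (fun a => (r.monotone (Fin.le_last a)).trans_eq hr),
        apply_castSucc_le (i := q) (hpred (by omega)).le
          (fun a => (c.monotone (Fin.le_last a)).trans_eq hc), rfl⟩
  · refine ⟨s, i, j, ?_, ?_⟩
    · have h1 := ht.rankAt_permC_le i j
      rw [h.rankAt_permP hij] at h1
      omega
    · rwa [initCoeff_of_degreeOf (degreeOf_eq_zero_of_mem_northwestMinors hij hmem)]

theorem IsLastDot.span_coneGens {t : Fin n} (ht : IsLastDot π p q t)
    (h : IsAccessible π p q) (hm : IsDiagonalOrder k m) :
    Ideal.span (coneGens (p, q) (essentialMinors k π)) = schubertIdeal k (permC π p q t) := by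
  apply le_antisymm
  · rw [Ideal.span_le]
    intro f hf
    obtain ⟨s, i, j, hs, hmem⟩ := ht.exists_of_mem_coneGens h hm hf
    exact northwestMinors_subset_schubertIdeal hs hmem
  · rw [schubertIdeal, Ideal.span_le]
    refine Set.iUnion₂_subset fun i j f hf => ?_
    rw [rankMinors_eq] at hf
    by_cases hR : t ≤ i ∧ i < p ∧ π t ≤ j ∧ j < q
    · rw [ht.one_add_rankAt_permC h hR.1 hR.2.1 hR.2.2.1 hR.2.2.2] at hf
      obtain ⟨r, c, hr, hc, rfl⟩ := hf
      -- Bordering the minor by row `p` and column `q` gives an essential minor of `π` in which it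
      -- is the coefficient of `y`.
      obtain ⟨r', rfl, hr'⟩ := exists_orderEmbedding_snoc r fun a => (hr a).trans_lt hR.2.1
      obtain ⟨c', rfl, hc'⟩ := exists_orderEmbedding_snoc c fun a => (hc a).trans_lt hR.2.2.2
      refine Ideal.subset_span ⟨genericMinor k r' c', ?_, initCoeff_genericMinor hm hr' hc'⟩
      apply rankMinors_subset_essentialMinors h.1
      rw [rankMinors_eq, add_comm]
      exact ⟨r', c', fun a => (r'.monotone (Fin.le_last a)).trans_eq hr',
        fun a => (c'.monotone (Fin.le_last a)).trans_eq hc', rfl⟩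
    · have h1 := ht.rankAt_permC i j
      rw [if_neg hR, add_zero] at h1
      rw [h1] at hf
      have h2 := northwestMinors_subset_schubertIdeal le_rfl hf
      rw [← h.span_sep_essentialMinors hm] at h2
      refine Ideal.span_mono ?_ h2
      rintro g ⟨hg, h0⟩
      exact ⟨g, hg, initCoeff_of_degreeOf h0⟩

end Accessible

theorem propositionp {k : Type*} [Field k] {n : ℕ} (m : MonomialOrder (Fin n × Fin n))
    (hm : IsDiagonalOrder k m) (π : Equiv.Perm (Fin n)) (hπ : IsVexillary π) (p q : Fin n)
    (hpq : IsAccessible π p q)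
    (hG : IsGroebnerBasis m (essentialMinors k π) (schubertIdeal k π)) :
    ∃ t : Fin n, IsCornerDot π p q t ∧
      -- (a)
      (Ideal.span (coneGens (p, q) (essentialMinors k π)) = schubertIdeal k (permC π p q t) ∧
        Ideal.span (projGens (p, q) (essentialMinors k π)) =
          schubertIdeal k (permP π p q) ⊔ Ideal.span {X (p, q)}) ∧
      -- (b)
      (IsGroebnerBasis m (coneGens (p, q) (essentialMinors k π))
          (Ideal.span (coneGens (p, q) (essentialMinors k π))) ∧
        IsGroebnerBasis m (projGens (p, q) (essentialMinors k π))
          (Ideal.span (projGens (p, q) (essentialMinors k π)))) ∧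
      -- (c)
      IsGroebnerBasis m (essentialMinors k (permC π p q t))
        (schubertIdeal k (permC π p q t)) ∧
      -- (d)
      (initIdeal (p, q) (schubertIdeal k π) =
          Ideal.span (degenGens (p, q) (essentialMinors k π)) ∧
        Ideal.span (degenGens (p, q) (essentialMinors k π)) =
          Ideal.span (coneGens (p, q) (essentialMinors k π)) ⊓
            Ideal.span (projGens (p, q) (essentialMinors k π))) := by
  have hL := hpq.linearInitial hm
  obtain ⟨t, ht⟩ := hpq.exists_isLastDot hπ
  have hC := ht.span_coneGens (k := k) hpq hm
  have hCG := hL.isGroebnerBasis_coneGens hG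
  refine ⟨t, ht.isCornerDot hpq, ⟨hC, ?_⟩, ⟨hCG, hL.isGroebnerBasis_projGens hG⟩, ?_,
    hL.initIdeal_eq hG, hL.span_degenGens_eq_inf⟩
  · rw [LinearInitial.span_projGens, hpq.span_sep_essentialMinors hm]
  · refine isGroebnerBasis_of_exists_degree_le (span_essentialMinors hm _) ?_ fun f hf hne => ?_
    · intro h0
      obtain ⟨e, -, r, c, -, -, h⟩ := Set.mem_iUnion₂.mp h0
      exact genericMinor_ne_zero hm r c h.symm
    · rw [← hC] at hf
      -- The `q_i` need not be essential minors of `π_C`, but they are large enough minors for one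
      -- of its rank conditions, which is enough for divisibility of diagonal terms.
      obtain ⟨g, hg, hle⟩ := hCG.exists_degree_le hL.zero_notMem_coneGens hf hne
      obtain ⟨s, i, j, hs, hmem⟩ := ht.exists_of_mem_coneGens hpq hm hg
      obtain ⟨g', hg', hle'⟩ := exists_essentialMinor_degree_le hm hs hmem
      exact ⟨g', hg', hle'.trans hle⟩
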